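/- A $3$-colouring template on a finite set $V$ is a triple $\mathbf{G}=(G_1,G_2,G_3)$ of (simple, not necessarily edge-disjoint) graphs on $V$. It is a Gallai colouring template if it contains no rainbow triangle, that is, if there are no three distinct vertices $x,y,z\in V$ and no bijection $(i,j,k)$ of the colours $\{1,2,3\}$ with $xy\in E(G_i)$, $yz\in E(G_j)$ and $xz\in E(G_k)$. Let $h(x)=\left(x^2+(1-x)^2\right)x^2\left(1-x^2\right)$ and let $\upsilon$ be the (unique) value of $x\in[0,1]$ maximising $h(x)$ over $[0,1]$. Corollary (conjecture of Frankl, Győri, He, Lv, Salia, Tompkins, Varga and Zhu). For every Gallai $3$-colouring template $\mathbf{G}$ on $n$ vertices, \[\Bigl(|E(G_1)|\cdot|E(G_2)|\cdot|E(G_3)|\Bigr)^{1/3}\le\bigl(h(\upsilon)+o(1)\bigr)^{1/3}\binom n2 ,\] where the $o(1)$ term depends only on $n$ and tends to $0$ as $n\to\infty$; that is, there is a sequence $(\varepsilon_n)_{n\ge 0}$ of real numbers with $\varepsilon_n\to 0$ and $h(\upsilon)+\varepsilon_n\ge 0$ for all $n$, such that for every $n$ and every Gallai $3$-colouring template on $n$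 vertices the inequality holds with $\varepsilon_n$ in place of $o(1)$. -/

import Mathlib

universe u

/-- An `r`-colouring template on `V`: an `r`-tuple of graphs on the vertex set `V`
(not required to be edge-disjoint). -/
abbrev ColouringTemplate (r : ℕ) (V : Type*) := Fin r → SimpleGraph V

namespace ColouringTemplate

variable {r : ℕ} {V W : Type*}

/-- The template `G` contains a copy of the `r`-coloured graph `(H, c)`: some injection of the
vertices of `H` into `V` sends every edge `e` of `H` to an edge of `G (c e)`. -/
def ContainsColoured (G : ColouringTemplate r V) (H : SimpleGraph W) (c : H.edgeSet → Fin r) :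
    Prop :=
  ∃ f : W → V, Function.Injective f ∧
    ∀ (x y : W) (hxy : H.Adj x y), (G (c ⟨s(x, y), hxy⟩)).Adj (f x) (f y)

/-- The template `G` contains a rainbow copy of `H`: it contains `(H, c)` for some colouring `c`
that assigns distinct colours to distinct edges of `H`. -/
def ContainsRainbow (G : ColouringTemplate r V) (H : SimpleGraph W) : Prop :=
  ∃ c : H.edgeSet → Fin r, Function.Injective c ∧ G.ContainsColoured H c

/-- A Gallai colouring template is one with no rainbow copy of the triangle `K₃`. -/
def IsGallai (G : ColouringTemplate r V) : Prop :=
  ¬ G.ContainsRainbow (⊤ : SimpleGraph (Fin 3))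

end ColouringTemplate

/-- The function `h(x) = (x² + (1 - x)²) x² (1 - x²)`. -/
def hFun (x : ℝ) : ℝ := (x ^ 2 + (1 - x) ^ 2) * x ^ 2 * (1 - x ^ 2)

theorem hasDerivAt_hFun (x : ℝ) :
    HasDerivAt hFun (2 * x * (-6 * x ^ 4 + 5 * x ^ 3 + 2 * x ^ 2 - 3 * x + 1)) x := by
  have h1 : HasDerivAt (fun x : ℝ => x ^ 2) (2 * x) x := by simpa using hasDerivAt_pow 2 x
  have h2 : HasDerivAt (fun x : ℝ => (1 - x) ^ 2) (2 * (1 - x) * (-1)) x := by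
    simpa using ((hasDerivAt_id x).const_sub 1).fun_pow 2
  have h3 := ((h1.fun_add h2).fun_mul h1).fun_mul (h1.const_sub 1)
  exact h3.congr_deriv (by ring)

/-- On `[0, 1]` the function `h` has exactly one maximiser. -/
theorem existsUnique_isMaxOn_hFun :
    ∃! x : ℝ, x ∈ Set.Icc (0 : ℝ) 1 ∧ IsMaxOn hFun (Set.Icc 0 1) x := by
  have key : ∀ x : ℝ, x ∈ Set.Icc (0 : ℝ) 1 → IsMaxOn hFun (Set.Icc 0 1) x →
      1 / 2 < x ∧ x < 1 ∧ -6 * x ^ 4 + 5 * x ^ 3 + 2 * x ^ 2 - 3 * x + 1 = 0 := by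
    intro x hx hm
    have hhalf : hFun (1 / 2) ≤ hFun x := hm (by constructor <;> norm_num)
    have hx0 : x ≠ 0 := by rintro rfl; norm_num [hFun] at hhalf
    have hx1 : x ≠ 1 := by rintro rfl; norm_num [hFun] at hhalf
    have h0 : 0 < x := lt_of_le_of_ne hx.1 hx0.symm
    have h1 : x < 1 := lt_of_le_of_ne hx.2 hx1
    have hd := (hm.isLocalMax (Icc_mem_nhds h0 h1)).hasDerivAt_eq_zero (hasDerivAt_hFun x)
    have hq : -6 * x ^ 4 + 5 * x ^ 3 + 2 * x ^ 2 - 3 * x + 1 = 0 := by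
      rcases mul_eq_zero.1 hd with h | h
      · exact absurd h (by positivity)
      · exact h
    refine ⟨?_, h1, hq⟩
    by_contra hle
    have hle : x ≤ 1 / 2 := not_lt.1 hle
    have e1 : 0 ≤ (1 - x) * (1 - 2 * x) := mul_nonneg (by linarith) (by linarith)
    have e2 : 0 < x ^ 3 * (5 - 6 * x) := mul_pos (by positivity) (by linarith)
    nlinarith
  have mono : ∀ x y : ℝ, 1 / 2 < x → x < y → y < 1 →
      -6 * x ^ 4 + 5 * x ^ 3 + 2 * x ^ 2 - 3 * x + 1 = 0 →
      -6 * y ^ 4 + 5 * y ^ 3 + 2 * y ^ 2 - 3 * y + 1 = 0 → False := by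
    intro x y hx hxy hy ex ey
    have hf : (y - x) * (-6 * (x ^ 3 + x ^ 2 * y + x * y ^ 2 + y ^ 3)
        + 5 * (x ^ 2 + x * y + y ^ 2) + 2 * (x + y) - 3) = 0 := by linear_combination ey - ex
    rcases mul_eq_zero.1 hf with h | h
    · linarith
    · have ha : 0 < x - 1 / 2 := by linarith
      have hb : 0 < y - 1 / 2 := by linarith
      obtain ⟨a, rfl⟩ : ∃ a, x = a + 1 / 2 := ⟨x - 1 / 2, by ring⟩
      obtain ⟨b, rfl⟩ : ∃ b, y = b + 1 / 2 := ⟨y - 1 / 2, by ring⟩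
      have ha : 0 < a := by linarith
      have hb : 0 < b := by linarith
      nlinarith [mul_pos ha hb, mul_pos (mul_pos ha hb) ha, mul_pos (mul_pos ha hb) hb,
        mul_nonneg ha.le (sq_nonneg (a - 1 / 12)), mul_nonneg hb.le (sq_nonneg (b - 1 / 12)),
        sq_nonneg (a - 1 / 24), sq_nonneg (b - 1 / 24), sq_nonneg (a - b)]
  have hcont : Continuous hFun := by unfold hFun; fun_prop
  obtain ⟨x, hx, hm⟩ := isCompact_Icc.exists_isMaxOn
    (Set.nonempty_Icc.2 (zero_le_one (α := ℝ))) hcont.continuousOn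
  refine ⟨x, ⟨hx, hm⟩, ?_⟩
  rintro y ⟨hy, hmy⟩
  obtain ⟨x1, x2, x3⟩ := key x hx hm
  obtain ⟨y1, y2, y3⟩ := key y hy hmy
  rcases lt_trichotomy y x with h | h | h
  · exact (mono y x y1 h x2 y3 x3).elim
  · exact h
  · exact (mono x y x1 h y2 x3 y3).elim

/-- The value `υ` of `x ∈ [0, 1]` that maximises `h(x)`. -/
noncomputable def upsilon : ℝ := existsUnique_isMaxOn_hFun.choose

theorem upsilon_spec :
    upsilon ∈ Set.Icc (0 : ℝ) 1 ∧ IsMaxOn hFun (Set.Icc 0 1) upsilon :=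
  existsUnique_isMaxOn_hFun.choose_spec.1

/-! Counting edges is replaced by weighted densities: put a probability weight on the vertices and
let `wdens` be the chance that two independent random vertices are adjacent. Uniform weights recover
`2|E|/n²`, so it suffices that every product of three densities is at most `h(υ)`
(`le_upsilon_of_mem_densityProducts`).

Suppose the supremum `M` of these products exceeds `h(υ)`. It need not be attained, so take a
template very close to `M`, optimise its weights by compactness and restrict to the support. Moving
weight towards one vertex shows that the degrees at each vertex, divided by the densities, sum to
`3`. Adding a new vertex joined to everything in one colour shows that each density is almost `1/3`
or more. These facts form `IsOpt`.

Order the densities as `R ≥ S ≥ T`. Then `R ≤ 0.858` (`IsOpt.wdens_le`). Since every vertex carries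
normalised degree `3`, any local configuration that caps the contribution of each third vertex too
low is impossible. This rules out edges in all three colours (`no_tri`). Let `A` be the set of
vertices incident to an edge in both `R` and `S`, and `m` its weight. `A` spans no `T`-edge
(`not_adj_of_bideg_pos`), `m ≥ 0.7418` (`le_sum_biInd`), and no edge of `R` or `S` leaves `A`
(`not_adj_of_bideg_pos_of_not`).

So the template is at best a clique in `R` and `S` on `A`, joined by `T` to the rest. Inside the
rest, `wdens_mul_wdens_le` limits how the three densities trade off, and `prod_le_hFun` shows that
nothing beats two complete colours there, one of them `T`. That configuration gives `h(m) ≤ h(υ)`.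
-/

/-! ### Weighted templates -/

/-- There is no rainbow triangle in the triple `(R, S, T)`. -/
def NoRainbow {V : Type*} (R S T : SimpleGraph V) : Prop :=
  ∀ x y z, R.Adj x y → S.Adj y z → T.Adj x z → False

open Classical in
/-- Adjacency indicator. -/
noncomputable def ind {V : Type*} (R : SimpleGraph V) (x y : V) : ℝ := if R.Adj x y then 1 else 0

/-- Weighted degree of a vertex. -/
noncomputable def wdeg {V : Type*} [Fintype V] (w : V → ℝ) (R : SimpleGraph V) (x : V) : ℝ :=
  ∑ y, w y * ind R x y

/-- Weighted edge density. -/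
noncomputable def wdens {V : Type*} [Fintype V] (w : V → ℝ) (R : SimpleGraph V) : ℝ :=
  ∑ x, w x * wdeg w R x

section basic

variable {V : Type*} {R S T : SimpleGraph V}

theorem NoRainbow.swap12 (h : NoRainbow R S T) : NoRainbow S R T :=
  fun x y z h1 h2 h3 => h z y x h2.symm h1.symm h3.symm

theorem NoRainbow.swap23 (h : NoRainbow R S T) : NoRainbow R T S :=
  fun x y z h1 h2 h3 => h y x z h1.symm h3 h2

theorem ind_of_adj {x y : V} (h : R.Adj x y) : ind R x y = 1 := if_pos h

theorem ind_of_not_adj {x y : V} (h : ¬ R.Adj x y) : ind R x y = 0 := if_neg h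

theorem ind_self (R : SimpleGraph V) (x : V) : ind R x x = 0 := if_neg (R.loopless.irrefl x)

theorem ind_comm (R : SimpleGraph V) (x y : V) : ind R x y = ind R y x := by
  by_cases a : R.Adj x y
  · rw [ind_of_adj a, ind_of_adj a.symm]
  · rw [ind_of_not_adj a, ind_of_not_adj fun b => a b.symm]

theorem ind_nonneg (R : SimpleGraph V) (x y : V) : 0 ≤ ind R x y := by
  unfold ind; split_ifs <;> norm_num

theorem ind_le_one (R : SimpleGraph V) (x y : V) : ind R x y ≤ 1 := by
  unfold ind; split_ifs <;> norm_num

variable [Fintype V] {w : V → ℝ}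

theorem wdeg_nonneg (hw : ∀ x, 0 ≤ w x) (R : SimpleGraph V) (x : V) : 0 ≤ wdeg w R x :=
  Finset.sum_nonneg fun y _ => mul_nonneg (hw y) (ind_nonneg R x y)

theorem wdeg_le_one (hw : ∀ x, 0 ≤ w x) (h1 : ∑ x, w x = 1) (R : SimpleGraph V) (x : V) :
    wdeg w R x ≤ 1 := by
  rw [← h1]
  exact Finset.sum_le_sum fun y _ => mul_le_of_le_one_right (hw y) (ind_le_one R x y)

theorem wdens_nonneg (hw : ∀ x, 0 ≤ w x) (R : SimpleGraph V) : 0 ≤ wdens w R :=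
  Finset.sum_nonneg fun x _ => mul_nonneg (hw x) (wdeg_nonneg hw R x)

theorem wdens_le_one (hw : ∀ x, 0 ≤ w x) (h1 : ∑ x, w x = 1) (R : SimpleGraph V) :
    wdens w R ≤ 1 := by
  conv_rhs => rw [← h1]
  exact Finset.sum_le_sum fun y _ => mul_le_of_le_one_right (hw y) (wdeg_le_one hw h1 R y)

theorem wdens_eq (w : V → ℝ) (R : SimpleGraph V) :
    wdens w R = ∑ x, ∑ y, w x * w y * ind R x y := by
  simp only [wdens, wdeg, Finset.mul_sum, mul_assoc]

theorem wdens_smul (c : ℝ) (w : V → ℝ) (R : SimpleGraph V) :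
    wdens (fun x => c * w x) R = c ^ 2 * wdens w R := by
  simp only [wdens_eq, Finset.mul_sum]
  exact Finset.sum_congr rfl fun x _ => Finset.sum_congr rfl fun y _ => by ring

/-- Double sums of the weights factor. -/
theorem sum_sum_mul (f g : V → ℝ) : ∑ x, ∑ y, f x * g y = (∑ x, f x) * ∑ y, g y := by
  rw [Finset.sum_mul_sum]

/-! ### Degrees inside colour neighbourhoods -/

/-- If `x` is joined to `z` in `S` and to `y` in `T`, then `yz` is not in `R`. -/
theorem two_mul_wdeg_mul_sub_le (h : NoRainbow R S T) (hw : ∀ x, 0 ≤ w x) (h1 : ∑ x, w x = 1)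
    (v : V) : 2 * wdeg w S v * wdeg w T v - (∑ z, w z * (ind S v z * ind T v z)) ^ 2 ≤
      1 - wdens w R := by
  -- Inclusion–exclusion for `(N_S × N_T) ∪ (N_T × N_S)`, whose two parts meet in the square of `N_S
  -- ∩ N_T`. No pair in this union is an edge of `R`.
  have e1 : 2 * wdeg w S v * wdeg w T v - (∑ z, w z * (ind S v z * ind T v z)) ^ 2 =
      ∑ x, ∑ y, w x * w y * (ind S v x * ind T v y + ind T v x * ind S v y -
        ind S v x * ind T v x * (ind S v y * ind T v y)) := by
    have : ∀ x y, w x * w y * (ind S v x * ind T v y + ind T v x * ind S v y -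
        ind S v x * ind T v x * (ind S v y * ind T v y)) =
        (w x * ind S v x) * (w y * ind T v y) + (w x * ind T v x) * (w y * ind S v y) -
        (w x * (ind S v x * ind T v x)) * (w y * (ind S v y * ind T v y)) := fun x y => by ring
    simp only [this, Finset.sum_add_distrib, Finset.sum_sub_distrib, sum_sum_mul, wdeg]
    ring
  have e2 : 1 - wdens w R = ∑ x, ∑ y, w x * w y * (1 - ind R x y) := by
    simp only [mul_sub, mul_one, Finset.sum_sub_distrib, ← wdens_eq, sum_sum_mul, h1]
  rw [e1, e2]
  refine Finset.sum_le_sum fun x _ => Finset.sum_le_sum fun y _ =>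
    mul_le_mul_of_nonneg_left ?_ (mul_nonneg (hw x) (hw y))
  have k1 : S.Adj v x → T.Adj v y → ¬ R.Adj x y := fun a b c => h y x v c.symm a.symm b.symm
  have k2 : T.Adj v x → S.Adj v y → ¬ R.Adj x y := fun a b c => h x y v c b.symm a.symm
  unfold ind
  split_ifs <;> first | (exfalso; tauto) | norm_num

theorem sum_ind_mul_le_left (hw : ∀ x, 0 ≤ w x) (v : V) :
    ∑ z, w z * (ind S v z * ind T v z) ≤ wdeg w S v :=
  Finset.sum_le_sum fun z _ => mul_le_mul_of_nonneg_left
    (mul_le_of_le_one_right (ind_nonneg _ _ _) (ind_le_one _ _ _)) (hw z)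

theorem sum_ind_mul_le_right (hw : ∀ x, 0 ≤ w x) (v : V) :
    ∑ z, w z * (ind S v z * ind T v z) ≤ wdeg w T v :=
  Finset.sum_le_sum fun z _ => mul_le_mul_of_nonneg_left
    (mul_le_of_le_one_left (ind_nonneg _ _ _) (ind_le_one _ _ _)) (hw z)

theorem sum_ind_mul_nonneg (hw : ∀ x, 0 ≤ w x) (v : V) :
    0 ≤ ∑ z, w z * (ind S v z * ind T v z) :=
  Finset.sum_nonneg fun z _ => mul_nonneg (hw z) (mul_nonneg (ind_nonneg _ _ _) (ind_nonneg _ _ _))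

theorem wdeg_mul_wdeg_le (h : NoRainbow R S T) (hw : ∀ x, 0 ≤ w x) (h1 : ∑ x, w x = 1) (v : V) :
    wdeg w S v * wdeg w T v ≤ 1 - wdens w R := by
  have := two_mul_wdeg_mul_sub_le h hw h1 v
  have a1 := sum_ind_mul_le_left (S := S) (T := T) hw v
  have a2 := sum_ind_mul_le_right (S := S) (T := T) hw v
  have a3 := sum_ind_mul_nonneg (S := S) (T := T) hw v
  nlinarith [mul_le_mul a1 a2 a3 (a3.trans a1)]

/-- The vertices joined to `v` in both `S` and `T` span no edge of `R`. -/
theorem sq_sum_ind_mul_le (h : NoRainbow R S T) (hw : ∀ x, 0 ≤ w x) (h1 : ∑ x, w x = 1) (v : V) :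
    (∑ z, w z * (ind S v z * ind T v z)) ^ 2 ≤ 1 - wdens w R := by
  have := wdeg_mul_wdeg_le h hw h1 v
  have a1 := sum_ind_mul_le_left (S := S) (T := T) hw v
  have a2 := sum_ind_mul_le_right (S := S) (T := T) hw v
  have a3 := sum_ind_mul_nonneg (S := S) (T := T) hw v
  nlinarith [mul_le_mul a1 a2 a3 (a3.trans a1)]

/-! ### Degrees and density -/

/-- A graph all of whose degrees are close to `0` or `1` has density close to `0` or `1`. -/
theorem wdens_mul_one_sub_le (hw : ∀ x, 0 ≤ w x) (h1 : ∑ x, w x = 1) (R : SimpleGraph V) :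
    wdens w R * (1 - wdens w R) ≤ 2 * ∑ v, w v * (wdeg w R v * (1 - wdeg w R v)) := by
  have c1 : ∀ y, ∑ x, w x * ind R x y = wdeg w R y := fun y =>
    Finset.sum_congr rfl fun x _ => by rw [ind_comm]
  have c2 : ∀ y, ∑ z, w z * (1 - ind R y z) = 1 - wdeg w R y := fun y => by
    simp only [mul_sub, mul_one, Finset.sum_sub_distrib, h1, wdeg]
  have e : 1 - wdens w R = ∑ z, w z * (1 - wdeg w R z) := by
    simp only [mul_sub, mul_one, Finset.sum_sub_distrib, h1, wdens]
  have lhs : wdens w R * (1 - wdens w R) =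
      ∑ y, ∑ z, w y * w z * (wdeg w R y * (1 - wdeg w R z)) := by
    rw [e, wdens, Finset.sum_mul_sum]
    exact Finset.sum_congr rfl fun y _ => Finset.sum_congr rfl fun z _ => by ring
  -- For a pair `y, z`, the product `deg y (1 − deg z)` is at most `deg y` if `yz` is a non-edge and
  -- at most `1 − deg z` if it is an edge. Summed over pairs, each of these two bounds gives the
  -- same quantity `∑ w v deg v (1 − deg v)`.
  have r1 : ∑ v, w v * (wdeg w R v * (1 - wdeg w R v)) =
      ∑ y, ∑ z, w y * w z * (wdeg w R y * (1 - ind R y z)) := by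
    refine Finset.sum_congr rfl fun y _ => ?_
    rw [← c2, Finset.mul_sum, Finset.mul_sum]
    exact Finset.sum_congr rfl fun z _ => by ring
  have r2 : ∑ v, w v * (wdeg w R v * (1 - wdeg w R v)) =
      ∑ y, ∑ z, w y * w z * (ind R y z * (1 - wdeg w R z)) := by
    rw [Finset.sum_comm]
    refine Finset.sum_congr rfl fun y _ => ?_
    rw [← c1, Finset.sum_mul, Finset.mul_sum]
    exact Finset.sum_congr rfl fun z _ => by ring
  rw [lhs, two_mul]
  nth_rewrite 1 [r1]
  rw [r2, ← Finset.sum_add_distrib]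
  refine Finset.sum_le_sum fun y _ => ?_
  rw [← Finset.sum_add_distrib]
  refine Finset.sum_le_sum fun z _ => ?_
  rw [← mul_add]
  refine mul_le_mul_of_nonneg_left ?_ (mul_nonneg (hw y) (hw z))
  have d1 := wdeg_nonneg hw R y
  have d2 := wdeg_le_one hw h1 R y
  have d3 := wdeg_nonneg hw R z
  have d4 := wdeg_le_one hw h1 R z
  unfold ind
  split_ifs <;> nlinarith

/-- In a template without rainbow triangles and without edges in all three colours, if `T` is
nearly complete then one of `R`, `S` is nearly empty, or many pairs have at most one colour. -/
theorem wdens_mul_wdens_le (h : NoRainbow R S T) (hw : ∀ x, 0 ≤ w x) (h1 : ∑ x, w x = 1)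
    (h2 : wdens w R + wdens w S + wdens w T ≤ 2) :
    wdens w R * wdens w S ≤
      3 * (1 - wdens w T) + 2 * (2 - wdens w R - wdens w S - wdens w T) := by
  have hT : NoRainbow T R S := h.swap23.swap12
  -- Write `r, s, t` for the densities and `δ = 1 − t`. By `h2`, `s ≤ 1 − r + δ`, so `r s ≤ r (1 −
  -- r) + δ`, and it remains to bound `r (1 − r)` through the degrees. At each vertex `deg_R deg_S ≤
  -- δ`, which yields `deg_R (1 − deg_R) ≤ 1 + 2δ − deg_R − deg_S`.
  have a := wdens_mul_one_sub_le hw h1 R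
  have b : ∑ v, w v * (wdeg w R v * (1 - wdeg w R v)) ≤
      ∑ v, (w v * (2 * (1 - wdens w T) + 1) - w v * wdeg w R v - w v * wdeg w S v) := by
    refine Finset.sum_le_sum fun v _ => ?_
    have d1 := wdeg_nonneg hw R v
    have d2 := wdeg_le_one hw h1 R v
    have d3 := wdeg_nonneg hw S v
    have d4 := wdeg_le_one hw h1 S v
    have k := wdeg_mul_wdeg_le hT hw h1 v
    have : wdeg w R v * (1 - wdeg w R v) ≤
        2 * (1 - wdens w T) + 1 - wdeg w R v - wdeg w S v := by
      nlinarith [mul_nonneg (sub_nonneg.2 d2) (sub_nonneg.2 d4), mul_nonneg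
        (sub_nonneg.2 d2) (show (0:ℝ) ≤ 1 + (1 - wdens w T) - wdeg w R v - wdeg w S v by
          nlinarith [mul_nonneg (sub_nonneg.2 d2) (sub_nonneg.2 d4)]),
        wdens_le_one hw h1 T]
    nlinarith [mul_le_mul_of_nonneg_left this (hw v)]
  simp only [Finset.sum_sub_distrib, ← Finset.sum_mul, h1] at b
  change _ ≤ _ - wdens w R - wdens w S at b
  have o1 := wdens_nonneg hw R
  have o2 := wdens_le_one hw h1 R
  have o3 := wdens_le_one hw h1 T
  nlinarith

end basic

/-! ### Vertices have a dominant colour when one density is large -/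

/-- Applied with `b, c` the two smaller densities, `x, y` the degrees in those colours, `s = 3 −
1/R` and `f = 1 − R`. Substituting the lower bound for `x` from `hxy` turns `y (2x − y)` into a
concave quadratic in `y`. It exceeds `f` at `0.35 c` by `h1`, and by `h2` at the point `t` where
that lower bound equals `y`, hence in between. Beyond `t`, `y (2x − y) ≥ y² ≥ t² > f`. -/
theorem le_of_mul_two_mul_sub_le {b c s f x y : ℝ} (hb : 0 < b) (hc : 0 < c) (hy : 0 ≤ y)
    (hyx : y ≤ x) (hs : 0 < s) (hf : y * (2 * x - y) ≤ f) (hxy : s ≤ x / b + y / c)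
    (h1 : f < 35 / 100 * c * (2 * b * (s - 35 / 100) - 35 / 100 * c))
    (h2 : f < (s * b * c / (b + c)) ^ 2) : y ≤ 35 / 100 * c := by
  by_contra hlt
  push Not at hlt
  set t := s * b * c / (b + c) with ht
  have ht0 : 0 < t := by positivity
  have htq : t * (b + c) = s * b * c := by rw [ht]; field_simp
  have hx : b * s - b * y / c ≤ x := by
    have := mul_le_mul_of_nonneg_left hxy hb.le
    have e : b * (x / b + y / c) = x + b * y / c := by field_simp
    linarith
  rcases le_total t y with hty | hty
  · nlinarith [mul_le_mul_of_nonneg_left hyx hy]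
  · have e2 : y * (2 * (b * s - b * y / c) - y) ≤ f :=
      le_trans (mul_le_mul_of_nonneg_left (by linarith) hy) hf
    have e3 : 2 * (b * s - b * t / c) - t = t := by
      field_simp
      linear_combination -2 * htq
    set y0 := 35 / 100 * c with hy0
    have e4 : y0 * (2 * (b * s - b * y0 / c) - y0) =
        35 / 100 * c * (2 * b * (s - 35 / 100) - 35 / 100 * c) := by
      rw [hy0]; field_simp
    rw [← e4] at h1
    have h2' : f < t * (2 * (b * s - b * t / c) - t) := by rw [e3]; nlinarith
    have key : (y * (2 * (b * s - b * y / c) - y)) * (t - y0) =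
        (t - y) * (y0 * (2 * (b * s - b * y0 / c) - y0)) +
        (y - y0) * (t * (2 * (b * s - b * t / c) - t)) +
        (2 * b / c + 1) * ((t - y0) * (y - y0) * (t - y)) := by
      field_simp
      ring
    have k1 : 0 < t - y0 := by linarith
    have k2 : 0 < y - y0 := by linarith
    have k3 : 0 ≤ t - y := by linarith
    have k4 : 0 ≤ (2 * b / c + 1) * ((t - y0) * (y - y0) * (t - y)) := by positivity
    nlinarith [mul_pos k2 (sub_pos.2 h2'), mul_nonneg k3 (sub_pos.2 h1).le,
      mul_le_mul_of_nonneg_right e2 k1.le]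

/-- Numerical side conditions for `le_of_mul_two_mul_sub_le`. -/
theorem dominant_bounds {a b c : ℝ} (ha : 858 / 1000 < a) (ha1 : a ≤ 1) (hcb : c ≤ b) (hba : b ≤ a)
    (hc : 1000 / 3001 ≤ c) (hp : 1567 / 10000 ≤ a * b * c) :
    0 < 3 - 1 / a ∧
    1 - a < 35 / 100 * c * (2 * b * ((3 - 1 / a) - 35 / 100) - 35 / 100 * c) ∧
    1 - a < 35 / 100 * b * (2 * c * ((3 - 1 / a) - 35 / 100) - 35 / 100 * b) ∧
    1 - a < ((3 - 1 / a) * b * c / (b + c)) ^ 2 := by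
  have ha0 : 0 < a := by linarith
  have hb0 : 0 < b := by linarith
  have hc0 : 0 < c := by linarith
  have hs : (18344 / 10000 : ℝ) ≤ 3 - 1 / a := by
    have : 1 / a ≤ 1 / (858 / 1000) := one_div_le_one_div_of_le (by norm_num) ha.le
    norm_num at this ⊢
    linarith
  set s := 3 - 1 / a with hsd
  have hv : 1567 / 10000 ≤ b * c := by nlinarith [mul_pos hb0 hc0]
  have hva : 1567 / 10000 ≤ a * (b * c) := by linarith [mul_assoc a b c]
  refine ⟨by linarith, ?_, ?_, ?_⟩
  · have k1 : 14844 / 10000 * (b * c) ≤ (s - 35 / 100) * (b * c) :=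
      mul_le_mul_of_nonneg_right (by linarith) (by positivity)
    have k2 : c * c ≤ b * c := mul_le_mul_of_nonneg_right hcb hc0.le
    have k3 : 1 - a < 91 / 100 * (b * c) := by
      have : a * (1 - a) < 91 / 100 * (a * (b * c)) := by nlinarith
      nlinarith
    nlinarith
  · have k1 : 14844 / 10000 * (b * c) ≤ (s - 35 / 100) * (b * c) :=
      mul_le_mul_of_nonneg_right (by linarith) (by positivity)
    have k3 : 1 - a < 10390 / 10000 * (b * c) - 1225 / 10000 * (b * b) := by
      rcases le_total b (55 / 100) with h | h
      · have : a * (1 - a) < 10390 / 10000 * (a * (b * c)) - 371 / 10000 * a := by nlinarith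
        nlinarith
      · nlinarith [mul_le_mul_of_nonneg_left hc hb0.le]
    nlinarith
  · have hbc : 0 < b + c := by linarith
    -- Both factors `3.001 b − 1` and `3.001 c − 1` are nonnegative, which bounds `b + c` by `3.001
    -- bc + 1/3.001`. The remaining inequality involves `a` alone.
    have hsum : 1567 / 10000 * (b + c) ≤ b * c * (3001 / 1000 * (1567 / 10000) + a * (33323 / 100000)) := by
      have g1 : 0 ≤ (3001 / 1000 * b - 1) * (3001 / 1000 * c - 1) :=
        mul_nonneg (by linarith) (by linarith)
      nlinarith
    have q : (1 - a) * (3001 / 1000 * (1567 / 10000) + a * (33323 / 100000)) ^ 2 <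
        (1567 / 10000 * (18344 / 10000)) ^ 2 := by
      obtain ⟨t, rfl⟩ : ∃ t, a = 858 / 1000 + t := ⟨a - 858 / 1000, by ring⟩
      have : 0 < t := by linarith
      nlinarith [pow_pos this 2, pow_pos this 3]
    rw [div_pow, lt_div_iff₀ (by positivity)]
    have h3 : (1567 / 10000 * (b + c)) ^ 2 ≤
        (b * c * (3001 / 1000 * (1567 / 10000) + a * (33323 / 100000))) ^ 2 :=
      pow_le_pow_left₀ (by positivity) hsum 2
    have h4 : (18344 / 10000) ^ 2 * (b * c) ^ 2 ≤ (s * b * c) ^ 2 := by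
      rw [← mul_pow]
      exact pow_le_pow_left₀ (by positivity) (by nlinarith [mul_pos hb0 hc0]) 2
    have h5 : (1 - a) * (1567 / 10000 * (b + c)) ^ 2 ≤
      (1 - a) * (b * c * (3001 / 1000 * (1567 / 10000) + a * (33323 / 100000))) ^ 2 :=
      mul_le_mul_of_nonneg_left h3 (by linarith)
    have h6 := mul_lt_mul_of_pos_right q (show 0 < (b * c) ^ 2 by positivity)
    nlinarith

/-! ### Optimal weighted templates -/

/-- A weighted template that is (nearly) optimal for the product of densities. -/
structure IsOpt {V : Type*} [Fintype V] (w : V → ℝ) (R S T : SimpleGraph V) : Prop where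
  pos : ∀ x, 0 < w x
  sum : ∑ x, w x = 1
  nr : NoRainbow R S T
  kkt : ∀ x, wdeg w R x / wdens w R + wdeg w S x / wdens w S + wdeg w T x / wdens w T = 3
  -- The constant is slightly below `1/3`, the bound at an exact optimum; `1567/10000` below is
  -- slightly less than `h(79/100)`, hence than `h(υ)`.
  lowR : 1000 / 3001 ≤ wdens w R
  lowS : 1000 / 3001 ≤ wdens w S
  lowT : 1000 / 3001 ≤ wdens w T
  prod : 1567 / 10000 ≤ wdens w R * wdens w S * wdens w T

namespace IsOpt

variable {V : Type*} [Fintype V] {w : V → ℝ} {R S T : SimpleGraph V}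

theorem swap12 (h : IsOpt w R S T) : IsOpt w S R T :=
  ⟨h.pos, h.sum, h.nr.swap12, fun x => by have := h.kkt x; linarith, h.lowS, h.lowR, h.lowT,
    by have := h.prod; linarith [mul_comm (wdens w R) (wdens w S)]⟩

theorem swap23 (h : IsOpt w R S T) : IsOpt w R T S :=
  ⟨h.pos, h.sum, h.nr.swap23, fun x => by have := h.kkt x; linarith, h.lowR, h.lowT, h.lowS,
    by have := h.prod; linarith [mul_right_comm (wdens w R) (wdens w S) (wdens w T)]⟩

theorem nonneg (h : IsOpt w R S T) (x : V) : 0 ≤ w x := (h.pos x).le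

/-- Edges inside the part of weight `f`, plus twice the degrees from the part of weight `g`. -/
theorem _root_.wdens_le_sq_add {f g : V → ℝ} (hf : ∀ x, 0 ≤ f x) (hg : ∀ x, 0 ≤ g x)
    (hw : ∀ x, f x + g x = w x) (S : SimpleGraph V) :
    wdens w S ≤ (∑ x, f x) ^ 2 + 2 * ∑ x, g x * wdeg w S x := by
  have h2 : ∑ x, g x * wdeg w S x = ∑ x, ∑ y, g y * (w x * ind S x y) := by
    rw [Finset.sum_comm]
    refine Finset.sum_congr rfl fun y _ => ?_
    rw [wdeg, Finset.mul_sum]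
    exact Finset.sum_congr rfl fun x _ => by rw [ind_comm]
  have h1 : ∑ x, g x * wdeg w S x = ∑ x, ∑ y, g x * (w y * ind S x y) := by
    simp only [wdeg, Finset.mul_sum]
  rw [two_mul]
  nth_rewrite 1 [h1]
  rw [h2, sq, Finset.sum_mul_sum, ← Finset.sum_add_distrib, ← Finset.sum_add_distrib, wdens_eq]
  refine Finset.sum_le_sum fun x _ => ?_
  rw [← Finset.sum_add_distrib, ← Finset.sum_add_distrib]
  refine Finset.sum_le_sum fun y _ => ?_
  rw [← hw x, ← hw y]
  have a1 := mul_nonneg (hf x) (hf y)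
  have a4 := mul_nonneg (hg x) (hg y)
  have d := ind_nonneg S x y
  have d' := ind_le_one S x y
  nlinarith [mul_nonneg a4 d, mul_nonneg a1 (sub_nonneg.2 d')]

open Classical in
-- If the largest density exceeded `0.858`, every vertex would have degree at most 35% of the
-- density in `S` or in `T`. Splitting the weight accordingly as `p + q = 1` gives `S (1 − 0.7 q) ≤
-- p²` and `T (1 − 0.7 p) ≤ q²`. Multiplying, with `pq ≤ 1/4`, makes `S T` less than `0.1567`.
theorem wdens_le (h : IsOpt w R S T) (hSR : wdens w S ≤ wdens w R) (hTS : wdens w T ≤ wdens w S) :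
    wdens w R ≤ 858 / 1000 := by
  by_contra hlt
  push Not at hlt
  have hR1 := wdens_le_one h.nonneg h.sum R
  obtain ⟨hs, b1, b2, b3⟩ := dominant_bounds hlt hR1 hTS hSR h.lowT h.prod
  have hR0 : 0 < wdens w R := by linarith
  have hT0 : 0 < wdens w T := by linarith [h.lowT]
  have hS0 : 0 < wdens w S := by linarith [h.lowT]
  have hdeg : ∀ x, 3 - 1 / wdens w R ≤ wdeg w S x / wdens w S + wdeg w T x / wdens w T := by
    intro x
    have := h.kkt x
    have : wdeg w R x / wdens w R ≤ 1 / wdens w R :=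
      div_le_div_of_nonneg_right (wdeg_le_one h.nonneg h.sum R x) hR0.le
    linarith
  have hloc := two_mul_wdeg_mul_sub_le h.nr h.nonneg h.sum
  have hn : ∀ x, 0 ≤ wdeg w S x := wdeg_nonneg h.nonneg S
  have hn' : ∀ x, 0 ≤ wdeg w T x := wdeg_nonneg h.nonneg T
  have hP : ∀ x, wdeg w T x ≤ wdeg w S x → wdeg w T x ≤ 35 / 100 * wdens w T := by
    intro x hx
    refine le_of_mul_two_mul_sub_le hS0 hT0 (hn' x) hx hs ?_ (hdeg x) b1 b3
    have := hloc x
    have a1 := sum_ind_mul_le_right (S := S) (T := T) h.nonneg x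
    have a2 := sum_ind_mul_nonneg (S := S) (T := T) h.nonneg x
    nlinarith
  have hQ : ∀ x, ¬ wdeg w T x ≤ wdeg w S x → wdeg w S x ≤ 35 / 100 * wdens w S := by
    intro x hx
    have hd := hdeg x
    rw [add_comm] at hd
    refine le_of_mul_two_mul_sub_le hT0 hS0 (hn x) (not_le.1 hx).le hs ?_ hd b2 ?_
    · have := hloc x
      have a1 := sum_ind_mul_le_left (S := S) (T := T) h.nonneg x
      have a2 := sum_ind_mul_nonneg (S := S) (T := T) h.nonneg x
      nlinarith
    · rwa [mul_right_comm, add_comm (wdens w T)]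
  set f : V → ℝ := fun x => if wdeg w T x ≤ wdeg w S x then w x else 0 with hf
  set g : V → ℝ := fun x => if wdeg w T x ≤ wdeg w S x then 0 else w x with hg
  have hf0 : ∀ x, 0 ≤ f x := fun x => by
    simp only [hf]; split_ifs
    exacts [h.nonneg x, le_rfl]
  have hg0 : ∀ x, 0 ≤ g x := fun x => by
    simp only [hg]; split_ifs
    exacts [le_rfl, h.nonneg x]
  have hfg : ∀ x, f x + g x = w x := fun x => by simp only [hf, hg]; split_ifs <;> simp
  have kS := wdens_le_sq_add hf0 hg0 hfg S
  have kT := wdens_le_sq_add hg0 hf0 (fun x => by rw [add_comm, hfg]) T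
  have lS : ∑ x, g x * wdeg w S x ≤ (∑ x, g x) * (35 / 100 * wdens w S) := by
    rw [Finset.sum_mul]
    refine Finset.sum_le_sum fun x _ => ?_
    by_cases hx : wdeg w T x ≤ wdeg w S x
    · simp [hg, hx]
    · exact mul_le_mul_of_nonneg_left (hQ x hx) (hg0 x)
  have lT : ∑ x, f x * wdeg w T x ≤ (∑ x, f x) * (35 / 100 * wdens w T) := by
    rw [Finset.sum_mul]
    refine Finset.sum_le_sum fun x _ => ?_
    by_cases hx : wdeg w T x ≤ wdeg w S x
    · exact mul_le_mul_of_nonneg_left (hP x hx) (hf0 x)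
    · simp [hf, hx]
  have hp0 : 0 ≤ ∑ x, f x := Finset.sum_nonneg fun x _ => hf0 x
  have hq0 : 0 ≤ ∑ x, g x := Finset.sum_nonneg fun x _ => hg0 x
  have hpq : ∑ x, f x + ∑ x, g x = 1 := by
    rw [← Finset.sum_add_distrib, ← h.sum]
    exact Finset.sum_congr rfl fun x _ => hfg x
  generalize ∑ x, f x = p at *
  generalize ∑ x, g x = q at *
  clear hQ hP hdeg hloc hn hn' b1 b2 b3 hf hg
  have fS : wdens w S * (1 - 7 / 10 * q) ≤ p ^ 2 := by linarith
  have fT : wdens w T * (1 - 7 / 10 * p) ≤ q ^ 2 := by linarith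
  have hm := mul_le_mul fS fT (mul_nonneg hT0.le (by linarith)) (sq_nonneg p)
  have hv : 1567 / 10000 ≤ wdens w S * wdens w T := by
    have := h.prod
    nlinarith [mul_pos hS0 hT0]
  have hr : p * q ≤ 1 / 4 := by nlinarith [sq_nonneg (p - q)]
  have hr0 : 0 ≤ p * q := mul_nonneg hp0 hq0
  have e1 : (1 - 7 / 10 * q) * (1 - 7 / 10 * p) = 3 / 10 + 49 / 100 * (p * q) := by
    linear_combination (-7 / 10) * hpq
  have f2 : wdens w S * wdens w T * (3 / 10 + 49 / 100 * (p * q)) ≤ (p * q) ^ 2 := by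
    rw [← e1]; linarith
  clear fS fT hm kS kT lS lT
  nlinarith [mul_le_mul_of_nonneg_right hv (show 0 ≤ 3 / 10 + 49 / 100 * (p * q) by positivity)]

end IsOpt

/-! ### Numerical estimates for the inverse densities -/

/-- The constraints on the inverse densities of an optimal template. -/
structure InvBounds (a b c : ℝ) : Prop where
  ha : 1000 / 858 ≤ a
  hab : a ≤ b
  hbc : b ≤ c
  hc : c ≤ 3001 / 1000
  prod : a * b * c ≤ 10000 / 1567

namespace InvBounds

variable {a b c : ℝ}

theorem pos_a (h : InvBounds a b c) : 0 < a := by linarith [h.ha]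
theorem pos_b (h : InvBounds a b c) : 0 < b := by linarith [h.ha, h.hab]
theorem pos_c (h : InvBounds a b c) : 0 < c := by linarith [h.ha, h.hab, h.hbc]

/-- With `a₀ = 1000/858`, expanding `(a − a₀)(b − a₀) ≥ 0` bounds `a + b` by `a₀ + ab/a₀`; then
multiply by `c`. -/
theorem add_mul_le (h : InvBounds a b c) :
    (a + b) * c ≤ 1000 / 858 * c + 858 / 1000 * (10000 / 1567) := by
  have h1 : 0 ≤ (a - 1000 / 858) * (b - 1000 / 858) :=
    mul_nonneg (by linarith [h.ha]) (by linarith [h.ha, h.hab])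
  nlinarith [mul_nonneg h1 h.pos_c.le, h.prod]

theorem mul_le (h : InvBounds a b c) : b * c ≤ 858 / 1000 * (10000 / 1567) := by
  have := mul_le_mul_of_nonneg_right h.ha (mul_pos h.pos_b h.pos_c).le
  nlinarith [h.prod]

/-- What matters is that the bound is below `6`, the total normalised degree of two vertices. -/
theorem sum_le (h : InvBounds a b c) : a + b + c ≤ 5992 / 1000 := by
  rcases le_total c (199 / 100) with hc | hc
  · linarith [h.hab, h.hbc]
  · have := h.add_mul_le
    have k : 0 ≤ (c - 199 / 100) * (3001 / 1000 - c) := mul_nonneg (by linarith) (by linarith [h.hc])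
    by_contra hlt
    push Not at hlt
    nlinarith [mul_lt_mul_of_pos_right hlt h.pos_c]

theorem add_le (h : InvBounds a b c) (hc : 2996 / 1000 ≤ c) : a + b ≤ 2994 / 1000 := by
  have := h.add_mul_le
  by_contra hlt
  push Not at hlt
  nlinarith [mul_lt_mul_of_pos_right hlt h.pos_c]

/-- The coefficient `0.259` exceeds `1 − 0.7418`, the largest possible weight outside `A`. -/
theorem add_mul_lt (h : InvBounds a b c) (hc : c < 2996 / 1000) : b + 259 / 1000 * c < 3 := by
  have h1 := h.mul_le
  have h2 := h.hbc
  have h3 := h.pos_b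
  by_contra hlt
  push Not at hlt
  nlinarith [mul_nonneg (sub_nonneg.2 h2) h3.le, mul_nonneg (sub_nonneg.2 h2) (sub_nonneg.2 hc.le)]

theorem one_lt (h : InvBounds a b c) (hc : c < 2996 / 1000) {s : ℝ} (hs0 : 0 ≤ s)
    (hs : 6 ≤ 2 * c + (a + b - c) * s) : 1 < s := by
  by_contra hlt
  push Not at hlt
  have := h.sum_le
  rcases le_total 0 (a + b - c) with h0 | h0
  · nlinarith
  · have := h.hab
    have := h.hbc
    have := h.ha
    nlinarith

/-- Here `p, q` are the bidegrees of the ends of an edge in both `R` and `S`. Since `1 − p = 1 − s +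
q` with `s = p + q`, a lower bound on `s` from `hs` and an upper bound on `q` from `hq` suffice. For
`c ≤ 2.34` constant bounds are enough; above that, bounds linear in `u = c − 2.34` are used. -/
theorem one_sub_mul_lt (h : InvBounds a b c) (hc : c < 2996 / 1000) {p q : ℝ} (hp0 : 0 ≤ p)
    (hs : 6 ≤ 2 * c + (a + b - c) * (p + q)) (hq0 : 0 ≤ q) (hq : q ^ 2 ≤ 1 - 1 / c) :
    (1 - p) * (b + c) < 3 := by
  have hs1 := h.one_lt hc (add_nonneg hp0 hq0) hs
  have hc0 := h.pos_c
  have hq' : q ^ 2 * c ≤ c - 1 := by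
    have := mul_le_mul_of_nonneg_right hq hc0.le
    rwa [sub_mul, one_mul, one_div, inv_mul_cancel₀ hc0.ne'] at this
  have hb0 := h.pos_b
  set s := p + q with hsd
  have hp : p = s - q := by rw [hsd]; ring
  rw [hp]
  rcases le_total c (234 / 100) with hc1 | hc1
  · have hs2 : 1132 / 1000 ≤ s := by
      rcases le_total c (185 / 100) with hc2 | hc2
      · have : (a + b - c) * s ≤ c * s :=
          mul_le_mul_of_nonneg_right (by linarith [h.hab, h.hbc]) (by linarith)
        nlinarith
      · have k1 : 0 ≤ (c - a) * (c - b) :=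
          mul_nonneg (by linarith [h.hab, h.hbc]) (by linarith [h.hbc])
        have k2 : (a + b - c) * c ^ 2 ≤ 10000 / 1567 := by nlinarith [h.prod]
        have k3 : c ^ 2 * (6 - 2 * c) ≤ 10000 / 1567 * s := by
          calc c ^ 2 * (6 - 2 * c) ≤ c ^ 2 * ((a + b - c) * s) :=
                mul_le_mul_of_nonneg_left (by linarith) (by positivity)
            _ = (a + b - c) * c ^ 2 * s := by ring
            _ ≤ _ := mul_le_mul_of_nonneg_right k2 (by linarith)
        have k4 : 7226 / 1000 ≤ c ^ 2 * (6 - 2 * c) := by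
          nlinarith [mul_nonneg (sub_nonneg.2 hc1) (sub_nonneg.2 hc2),
            mul_nonneg (mul_nonneg (sub_nonneg.2 hc1) (sub_nonneg.2 hc2)) hc0.le]
        linarith
    have hq2 : q ≤ 757 / 1000 := by
      by_contra hlt
      push Not at hlt
      nlinarith [mul_lt_mul_of_pos_right (pow_lt_pow_left₀ hlt (by norm_num) two_ne_zero) hc0]
    nlinarith [h.hbc]
  · obtain ⟨u, hu⟩ : ∃ u, c = 234 / 100 + u := ⟨c - 234 / 100, by ring⟩
    have hu0 : 0 ≤ u := by linarith
    have hu1 : u ≤ 656 / 1000 := by linarith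
    have hs2 : 113 / 100 + 17 / 100 * u ≤ s := by
      have k1 : c * (6 - 2 * c) ≤ (1000 / 858 * c + 858 / 1000 * (10000 / 1567) - c ^ 2) * s := by
        calc c * (6 - 2 * c) ≤ c * ((a + b - c) * s) :=
              mul_le_mul_of_nonneg_left (by linarith) hc0.le
          _ = ((a + b) * c - c ^ 2) * s := by ring
          _ ≤ _ := mul_le_mul_of_nonneg_right (by linarith [h.add_mul_le]) (by linarith)
      by_contra hlt
      push Not at hlt
      have k2 : (1000 / 858 * c + 858 / 1000 * (10000 / 1567) - c ^ 2) *
          (113 / 100 + 17 / 100 * u) ≤ c * (6 - 2 * c) := by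
        rw [hu]
        nlinarith [mul_nonneg hu0 (sub_nonneg.2 hu1),
          mul_nonneg (mul_nonneg hu0 (sub_nonneg.2 hu1)) hu0, pow_nonneg hu0 3]
      have k3 : 0 < c * (6 - 2 * c) := mul_pos hc0 (by linarith)
      have k4 : 0 < 1000 / 858 * c + 858 / 1000 * (10000 / 1567) - c ^ 2 := by
        by_contra hn
        push Not at hn
        nlinarith
      nlinarith [mul_lt_mul_of_pos_left hlt k4]
    have hq2 : q ≤ 757 / 1000 + 122 / 1000 * u := by
      by_contra hlt
      push Not at hlt
      have := mul_lt_mul_of_pos_right (pow_lt_pow_left₀ hlt (by positivity) two_ne_zero) hc0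
      rw [hu] at this hq'
      nlinarith [pow_nonneg hu0 3, pow_nonneg hu0 2]
    have hw : b + c ≤ 469 / 100 + 22 / 100 * u := by
      have := h.mul_le
      by_contra hlt
      push Not at hlt
      have := mul_lt_mul_of_pos_right hlt hc0
      rw [hu] at *
      nlinarith [mul_nonneg hu0 (sub_nonneg.2 hu1)]
    have hp1 : 1 - (s - q) ≤ 627 / 1000 - 48 / 1000 * u := by linarith
    calc (1 - (s - q)) * (b + c) ≤ (627 / 1000 - 48 / 1000 * u) * (b + c) :=
          mul_le_mul_of_nonneg_right hp1 (by linarith)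
      _ ≤ (627 / 1000 - 48 / 1000 * u) * (469 / 100 + 22 / 100 * u) :=
          mul_le_mul_of_nonneg_left hw (by linarith)
      _ < 3 := by nlinarith [mul_nonneg hu0 hu0]

end InvBounds

/-- The final estimate: a clique of weight `m` in colours `1` and `2`, joined in colour `3` to a
template of densities `r`, `s`, `t`. -/
theorem prod_le_hFun {m r s t : ℝ} (hm : 7418 / 10000 ≤ m) (hm1 : m ≤ 1)
    (ht0 : 0 ≤ t) (ht : t ≤ 1) (h2 : r + s + t ≤ 2)
    (hrs : r * s ≤ 3 * (1 - t) + 2 * (2 - r - s - t)) :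
    (m ^ 2 + (1 - m) ^ 2 * r) * (m ^ 2 + (1 - m) ^ 2 * s) *
      (2 * m * (1 - m) + (1 - m) ^ 2 * t) ≤ hFun m := by
  set y := 1 - m with hy
  have hy0 : 0 ≤ y := by linarith
  have hy1 : y ≤ 2582 / 10000 := by linarith
  have hm0 : 0 < m := by linarith
  have hy2 : y ^ 2 ≤ 667 / 10000 := by nlinarith
  have hm2 : 5502 / 10000 ≤ m ^ 2 := by nlinarith
  have k : (m ^ 2 + 3 * y ^ 2) * (1 - m ^ 2) ≤ m ^ 2 * (m ^ 2 + y ^ 2) := by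
    obtain ⟨e, rfl⟩ : ∃ e, m = 7418 / 10000 + e := ⟨m - 7418 / 10000, by ring⟩
    have he : 0 ≤ e := by linarith
    rw [hy]
    nlinarith [pow_nonneg he 2, pow_nonneg he 3, pow_nonneg he 4]
  have hD : 0 ≤ 1 - m ^ 2 := by nlinarith
  have e1 : 2 * m * y + y ^ 2 * t = (1 - m ^ 2) - y ^ 2 * (1 - t) := by rw [hy]; ring
  have e2 : hFun m = (m ^ 2 * (m ^ 2 + y ^ 2)) * (1 - m ^ 2) := by rw [hFun, hy]; ring
  -- With `d = 2 − r − s − t`, the left side is at most the right side minus `y² d (m² − 2y²)`, and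
  -- `m² ≥ 2y²`.
  have hE : (m ^ 2 + y ^ 2 * r) * (m ^ 2 + y ^ 2 * s) ≤
      m ^ 2 * (m ^ 2 + y ^ 2) + y ^ 2 * (1 - t) * (m ^ 2 + 3 * y ^ 2) := by
    have g1 : 0 ≤ y ^ 2 * (2 - r - s - t) * (m ^ 2 - 2 * y ^ 2) :=
      mul_nonneg (mul_nonneg (by positivity) (by linarith)) (by linarith)
    have g2 := mul_le_mul_of_nonneg_left hrs (show 0 ≤ y ^ 2 * y ^ 2 by positivity)
    nlinarith
  rw [e1, e2]
  have hz : 0 ≤ y ^ 2 * (1 - t) := mul_nonneg (by positivity) (by linarith)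
  have hF : 0 ≤ (1 - m ^ 2) - y ^ 2 * (1 - t) := by rw [← e1]; positivity
  refine (mul_le_mul_of_nonneg_right hE hF).trans ?_
  -- With `z = y² (1 − t)` the bound is `(A + zB)(D − z) = AD + z (BD − A) − z² B`, and `k` says `BD
  -- ≤ A`.
  nlinarith [mul_le_mul_of_nonneg_left k hz, mul_nonneg (mul_nonneg hz hz)
    (show 0 ≤ m ^ 2 + 3 * y ^ 2 by positivity)]

/-- Weighted number of common `R`- and `S`-neighbours. -/
noncomputable def bideg {V : Type*} [Fintype V] (w : V → ℝ) (R S : SimpleGraph V) (x : V) : ℝ :=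
  ∑ z, w z * (ind R x z * ind S x z)

theorem mul_eq_one_of_ind {V : Type*} {R S : SimpleGraph V} {x y : V} (h : R.Adj x y)
    (h' : S.Adj x y) : ind R x y * ind S x y = 1 := by rw [ind_of_adj h, ind_of_adj h', one_mul]

/-- The six ways in which a triangle may not be coloured. -/
theorem NoRainbow.perms {V : Type*} {R S T : SimpleGraph V} (h : NoRainbow R S T) (x y z : V) :
    (R.Adj x y → S.Adj y z → T.Adj x z → False) ∧ (R.Adj x y → S.Adj x z → T.Adj y z → False) ∧
    (S.Adj x y → R.Adj y z → T.Adj x z → False) ∧ (S.Adj x y → R.Adj x z → T.Adj y z → False) ∧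
    (T.Adj x y → R.Adj y z → S.Adj x z → False) ∧ (T.Adj x y → R.Adj x z → S.Adj y z → False) :=
  ⟨h x y z, fun a b c => h y x z a.symm b c, fun a b c => h z y x b.symm a.symm c.symm,
    fun a b c => h z x y b.symm a c.symm, fun a b c => h y z x b c.symm a.symm,
    fun a b c => h x z y b c.symm a⟩

namespace IsOpt

variable {V : Type*} [Fintype V] {w : V → ℝ} {R S T : SimpleGraph V}

/-! ### The shape of an optimal template -/

theorem bideg_nonneg (h : IsOpt w R S T) (x : V) : 0 ≤ bideg w R S x :=
  sum_ind_mul_nonneg h.nonneg x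

theorem sq_bideg_le (h : IsOpt w R S T) (x : V) : bideg w R S x ^ 2 ≤ 1 - wdens w T :=
  sq_sum_ind_mul_le h.nr.swap23.swap12 h.nonneg h.sum x

theorem invBounds (h : IsOpt w R S T) (hSR : wdens w S ≤ wdens w R) (hTS : wdens w T ≤ wdens w S) :
    InvBounds (1 / wdens w R) (1 / wdens w S) (1 / wdens w T) := by
  have hT0 : 0 < wdens w T := by linarith [h.lowT]
  have hS0 : 0 < wdens w S := by linarith
  have hR0 : 0 < wdens w R := by linarith
  refine ⟨?_, one_div_le_one_div_of_le hS0 hSR, one_div_le_one_div_of_le hT0 hTS, ?_, ?_⟩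
  · have := one_div_le_one_div_of_le hR0 (h.wdens_le hSR hTS)
    norm_num at this ⊢
    exact this
  · have := one_div_le_one_div_of_le (by norm_num) h.lowT
    norm_num at this ⊢
    exact this
  · have := one_div_le_one_div_of_le (by norm_num) h.prod
    rw [one_div_mul_one_div, one_div_mul_one_div]
    norm_num at this ⊢
    exact this

/-- With `six_le`, this is the tool for excluding configurations: any pointwise cap on what a vertex
`z` contributes to the normalised degree of `x` must have average at least `3`. -/
theorem three_le (h : IsOpt w R S T) (x : V) (B : V → ℝ)
    (hB : ∀ z, 1 / wdens w R * ind R x z + 1 / wdens w S * ind S x z + 1 / wdens w T * ind T x z ≤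
      B z) : 3 ≤ ∑ z, w z * B z := by
  rw [← h.kkt x]
  simp only [wdeg, Finset.sum_div, ← Finset.sum_add_distrib]
  refine Finset.sum_le_sum fun z _ => ?_
  refine le_trans (le_of_eq ?_) (mul_le_mul_of_nonneg_left (hB z) (h.nonneg z))
  ring

theorem six_le (h : IsOpt w R S T) (x y : V) (B : V → ℝ)
    (hB : ∀ z, 1 / wdens w R * (ind R x z + ind R y z) + 1 / wdens w S * (ind S x z + ind S y z) +
      1 / wdens w T * (ind T x z + ind T y z) ≤ B z) : 6 ≤ ∑ z, w z * B z := by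
  have h1 := h.three_le x _ fun z => le_rfl
  have h2 := h.three_le y _ fun z => le_rfl
  have : ∑ z, w z * (1 / wdens w R * ind R x z + 1 / wdens w S * ind S x z +
      1 / wdens w T * ind T x z) + ∑ z, w z * (1 / wdens w R * ind R y z +
      1 / wdens w S * ind S y z + 1 / wdens w T * ind T y z) ≤ ∑ z, w z * B z := by
    rw [← Finset.sum_add_distrib]
    refine Finset.sum_le_sum fun z _ => ?_
    refine le_trans (le_of_eq ?_) (mul_le_mul_of_nonneg_left (hB z) (h.nonneg z))
    ring
  linarith

theorem sum_mul_const (h : IsOpt w R S T) (c : ℝ) : ∑ z, w z * c = c := by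
  rw [← Finset.sum_mul, h.sum, one_mul]

/-- Some vertex has at least average weighted number of common neighbours. -/
theorem exists_le_bideg (h : IsOpt w R S T) :
    ∃ x, wdens w R + wdens w S - 1 ≤ bideg w R S x := by
  by_contra hlt
  push Not at hlt
  have h0 : wdens w R + wdens w S - 1 ≤ ∑ x, w x * bideg w R S x := by
    have h1 : (1 : ℝ) = ∑ x, ∑ y, w x * w y := by rw [sum_sum_mul, h.sum, one_mul]
    simp only [bideg, Finset.mul_sum]
    rw [h1, wdens_eq, wdens_eq, ← Finset.sum_add_distrib, ← Finset.sum_sub_distrib]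
    refine Finset.sum_le_sum fun x _ => ?_
    rw [← Finset.sum_add_distrib, ← Finset.sum_sub_distrib]
    refine Finset.sum_le_sum fun y _ => ?_
    have := mul_nonneg (mul_nonneg (h.nonneg x) (h.nonneg y))
      (mul_nonneg (sub_nonneg.2 (ind_le_one R x y)) (sub_nonneg.2 (ind_le_one S x y)))
    linarith
  have hne : Nonempty V := by
    by_contra hn
    rw [not_nonempty_iff] at hn
    simpa using h.sum
  have h1 : ∑ x, w x * bideg w R S x < ∑ x, w x * (wdens w R + wdens w S - 1) :=
    Finset.sum_lt_sum_of_nonempty Finset.univ_nonempty fun x _ =>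
      mul_lt_mul_of_pos_left (hlt x) (h.pos x)
  rw [h.sum_mul_const] at h1
  linarith

theorem exists_adj_of_bideg_pos {x : V} (hx : 0 < bideg w R S x) :
    ∃ y, R.Adj x y ∧ S.Adj x y := by
  by_contra hn
  push Not at hn
  have : bideg w R S x = 0 := Finset.sum_eq_zero fun y _ => by
    by_cases hy : R.Adj x y
    · rw [ind_of_not_adj (hn y hy), mul_zero, mul_zero]
    · rw [ind_of_not_adj hy, zero_mul, mul_zero]
  linarith

/-- Otherwise `R S ≥ 0.469`, so some `x` has bidegree at least `0.21` and lies on an `RS`-edge `xy`.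
A third vertex contributes at most `6.002` to `x` and `y` together, and at most `5.9922` if it is a
common `R`- and `S`-neighbour of `x`. The average is then below `6`. -/
theorem inv_lt (h : IsOpt w R S T) (hSR : wdens w S ≤ wdens w R) (hTS : wdens w T ≤ wdens w S) :
    1 / wdens w T < 2996 / 1000 := by
  by_contra hlt
  push Not at hlt
  have b := h.invBounds hSR hTS
  obtain ⟨x, hx⟩ := h.exists_le_bideg
  have hx1 : 21 / 100 ≤ bideg w R S x := by
    have hT0 : 0 < wdens w T := by linarith [h.lowT]
    have t1 : wdens w T ≤ 1000 / 2996 := by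
      rw [le_one_div (by norm_num) hT0] at hlt
      norm_num at hlt ⊢
      exact hlt
    have t2 : 469 / 1000 ≤ wdens w R * wdens w S := by
      have := h.prod
      have : 0 ≤ wdens w R * wdens w S := mul_nonneg (by linarith) (by linarith)
      nlinarith
    have : 121 / 100 ≤ wdens w R + wdens w S := by
      nlinarith [sq_nonneg (wdens w R - wdens w S)]
    linarith
  obtain ⟨y, hR, hS⟩ := exists_adj_of_bideg_pos (by linarith : 0 < bideg w R S x)
  have b1 := b.sum_le
  have b2 := b.add_le hlt
  have b3 := b.hab
  have b4 := b.hbc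
  have b5 := b.hc
  have b6 := b.pos_a
  have key := h.six_le x y (fun z => 6002 / 1000 - 98 / 10000 * (ind R x z * ind S x z)) ?_
  · have : ∑ z, w z * (6002 / 1000 - 98 / 10000 * (ind R x z * ind S x z)) =
        6002 / 1000 - 98 / 10000 * bideg w R S x := by
      have e : ∀ z, w z * (6002 / 1000 - 98 / 10000 * (ind R x z * ind S x z)) =
        w z * (6002 / 1000) - 98 / 10000 * (w z * (ind R x z * ind S x z)) := fun z => by ring
      simp only [e, Finset.sum_sub_distrib, h.sum_mul_const, ← Finset.mul_sum, bideg]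
    linarith
  · intro z
    generalize 1 / wdens w R = l1 at *
    generalize 1 / wdens w S = l2 at *
    generalize 1 / wdens w T = l3 at *
    obtain ⟨n1, n2, n3, n4, n5, n6⟩ := h.nr.perms x y z
    unfold ind
    split_ifs <;> first | exact (n1 hR ‹_› ‹_›).elim | exact (n2 hR ‹_› ‹_›).elim |
      exact (n3 hS ‹_› ‹_›).elim | exact (n4 hS ‹_› ‹_›).elim | linarith

/-- If `xy` has all three colours, then for each `z` either one of `xz`, `yz` is uncoloured or both
carry the same single colour. So `z` contributes at most `max (a + b + c) (2c)` in inverse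
densities, which is below `6`. -/
theorem no_tri (h : IsOpt w R S T) (hSR : wdens w S ≤ wdens w R) (hTS : wdens w T ≤ wdens w S)
    {x y : V} (hR : R.Adj x y) (hS : S.Adj x y) (hT : T.Adj x y) : False := by
  have b := h.invBounds hSR hTS
  have b1 := b.sum_le
  have b2 := h.inv_lt hSR hTS
  have b3 := b.hab
  have b4 := b.hbc
  have b6 := b.pos_a
  have key := h.six_le x y (fun z => 5992 / 1000) ?_
  · rw [h.sum_mul_const] at key
    norm_num at key
  · intro z
    generalize 1 / wdens w R = l1 at *
    generalize 1 / wdens w S = l2 at *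
    generalize 1 / wdens w T = l3 at *
    obtain ⟨n1, n2, n3, n4, n5, n6⟩ := h.nr.perms x y z
    unfold ind
    split_ifs <;> first | exact (n1 hR ‹_› ‹_›).elim | exact (n2 hR ‹_› ‹_›).elim |
      exact (n3 hS ‹_› ‹_›).elim | exact (n4 hS ‹_› ‹_›).elim |
      exact (n5 hT ‹_› ‹_›).elim | exact (n6 hT ‹_› ‹_›).elim | linarith

/-- For an `RS`-edge `xy`, each `z` contributes at most twice the largest inverse density, with the
correction `1/R + 1/S − 1/T` for each of `x`, `y` that sees `z` in both `R` and `S`. -/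
theorem bideg_add_bideg (h : IsOpt w R S T) (hSR : wdens w S ≤ wdens w R)
    (hTS : wdens w T ≤ wdens w S) {x y : V} (hR : R.Adj x y) (hS : S.Adj x y) :
    6 ≤ 2 * (1 / wdens w T) + (1 / wdens w R + 1 / wdens w S - 1 / wdens w T) *
      (bideg w R S x + bideg w R S y) := by
  have b := h.invBounds hSR hTS
  have b3 := b.hab
  have b4 := b.hbc
  have b6 := b.pos_a
  have key := h.six_le x y (fun z => 2 * (1 / wdens w T) +
    (1 / wdens w R + 1 / wdens w S - 1 / wdens w T) *
      (ind R x z * ind S x z + ind R y z * ind S y z)) ?_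
  · have e : ∀ z, w z * (2 * (1 / wdens w T) + (1 / wdens w R + 1 / wdens w S - 1 / wdens w T) *
      (ind R x z * ind S x z + ind R y z * ind S y z)) = w z * (2 * (1 / wdens w T)) +
      (1 / wdens w R + 1 / wdens w S - 1 / wdens w T) *
      (w z * (ind R x z * ind S x z) + w z * (ind R y z * ind S y z)) := fun z => by ring
    simpa only [e, Finset.sum_add_distrib, h.sum_mul_const, ← Finset.mul_sum, bideg] using key
  · intro z
    have m1 := fun a b c => h.no_tri hSR hTS (x := x) (y := z) a b c
    have m2 := fun a b c => h.no_tri hSR hTS (x := y) (y := z) a b c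
    generalize 1 / wdens w R = l1 at *
    generalize 1 / wdens w S = l2 at *
    generalize 1 / wdens w T = l3 at *
    obtain ⟨n1, n2, n3, n4, n5, n6⟩ := h.nr.perms x y z
    unfold ind
    split_ifs <;> first | exact (n1 hR ‹_› ‹_›).elim | exact (n2 hR ‹_› ‹_›).elim |
      exact (n3 hS ‹_› ‹_›).elim | exact (n4 hS ‹_› ‹_›).elim |
      exact (m1 ‹_› ‹_› ‹_›).elim | exact (m2 ‹_› ‹_› ‹_›).elim | linarith

end IsOpt

/-! ### The set `A` of vertices incident to edges in both `R` and `S` -/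

namespace IsOpt

variable {V : Type*} [Fintype V] {w : V → ℝ} {R S T : SimpleGraph V}

theorem bideg_bounds_of_adj (h : IsOpt w R S T) (hSR : wdens w S ≤ wdens w R)
    (hTS : wdens w T ≤ wdens w S) {x y : V} (hR : R.Adj x y) (hS : S.Adj x y) :
    1 < bideg w R S x + bideg w R S y ∧
      (1 - bideg w R S x) * (1 / wdens w S + 1 / wdens w T) < 3 := by
  have b := h.invBounds hSR hTS
  have hs := h.bideg_add_bideg hSR hTS hR hS
  refine ⟨b.one_lt (h.inv_lt hSR hTS) (add_nonneg (h.bideg_nonneg x) (h.bideg_nonneg y)) hs,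
    b.one_sub_mul_lt (h.inv_lt hSR hTS) (h.bideg_nonneg x) hs (h.bideg_nonneg y) ?_⟩
  rw [one_div_one_div]
  exact h.sq_bideg_le y

theorem one_sub_bideg_mul_lt (h : IsOpt w R S T) (hSR : wdens w S ≤ wdens w R)
    (hTS : wdens w T ≤ wdens w S) {x : V} (hx : 0 < bideg w R S x) :
    (1 - bideg w R S x) * (1 / wdens w S + 1 / wdens w T) < 3 := by
  obtain ⟨y, hR, hS⟩ := exists_adj_of_bideg_pos hx
  exact (h.bideg_bounds_of_adj hSR hTS hR hS).2

theorem bideg_pos (h : IsOpt w R S T) {x y : V} (hR : R.Adj x y) (hS : S.Adj x y) :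
    0 < bideg w R S x := by
  refine Finset.sum_pos' (fun z _ => mul_nonneg (h.nonneg z)
    (mul_nonneg (ind_nonneg R x z) (ind_nonneg S x z))) ⟨y, Finset.mem_univ y, ?_⟩
  rw [mul_eq_one_of_ind hR hS, mul_one]
  exact h.pos y

theorem sum_mul_one_sub (h : IsOpt w R S T) (c : ℝ) (a : V) :
    ∑ z, w z * (c * (1 - ind R a z * ind S a z)) = (1 - bideg w R S a) * c := by
  have e : ∀ z, w z * (c * (1 - ind R a z * ind S a z)) =
      w z * c - c * (w z * (ind R a z * ind S a z)) := fun z => by ring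
  simp only [e, Finset.sum_sub_distrib, h.sum_mul_const, ← Finset.mul_sum, bideg]
  ring

/-- No vertex is disconnected from all the common `R`- and `S`-neighbours of a vertex. -/
theorem exists_adj_of_bideg (h : IsOpt w R S T) (hSR : wdens w S ≤ wdens w R)
    (hTS : wdens w T ≤ wdens w S) {a x : V} (ha : 0 < bideg w R S a)
    (hx : ∀ z, R.Adj a z → S.Adj a z → ¬ R.Adj x z ∧ ¬ S.Adj x z ∧ ¬ T.Adj x z) : False := by
  have b := h.invBounds hSR hTS
  have b3 := b.hab
  have b4 := b.hbc
  have b6 := b.pos_a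
  have hlt := h.one_sub_bideg_mul_lt hSR hTS ha
  rw [← h.sum_mul_one_sub] at hlt
  -- Common neighbours of `a` contribute nothing to `x`; by `no_tri` any other vertex contributes at
  -- most `1/S + 1/T`.
  refine absurd (h.three_le x _ fun z => ?_) (not_le.2 hlt)
  have m1 := fun a b c => h.no_tri hSR hTS (x := x) (y := z) a b c
  have m2 := fun a b => (hx z a b).1
  have m3 := fun a b => (hx z a b).2.1
  have m4 := fun a b => (hx z a b).2.2
  generalize 1 / wdens w R = l1 at *
  generalize 1 / wdens w S = l2 at *
  generalize 1 / wdens w T = l3 at *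
  unfold ind
  split_ifs <;> first | exact (m1 ‹_› ‹_› ‹_›).elim | exact (m2 ‹_› ‹_› ‹_›).elim |
    exact (m3 ‹_› ‹_› ‹_›).elim | exact (m4 ‹_› ‹_› ‹_›).elim | linarith

theorem bideg_add_le_one (h : IsOpt w R S T) {x y : V} (hT : T.Adj x y) :
    bideg w R S x + bideg w R S y ≤ 1 := by
  rw [bideg, bideg, ← Finset.sum_add_distrib, ← h.sum]
  refine Finset.sum_le_sum fun z _ => ?_
  obtain ⟨n1, n2, n3, n4, n5, n6⟩ := h.nr.perms x y z
  rw [← mul_add]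
  refine mul_le_of_le_one_right (h.nonneg z) ?_
  unfold ind
  split_ifs <;> first | exact (n6 hT ‹_› ‹_›).elim | norm_num

/-- By `exists_adj_of_bideg`, `x` is joined to some `RS`-neighbour `v` of `y`, necessarily in `T`;
likewise `y` to some `RS`-neighbour `v'` of `x`. The bidegrees on the `RS`-edges `yv` and `xv'` sum
to more than `2` in total, those on the `T`-edges `xv` and `yv'` to at most `2`, and these are the
same four numbers. -/
theorem not_adj_of_bideg_pos (h : IsOpt w R S T) (hSR : wdens w S ≤ wdens w R)
    (hTS : wdens w T ≤ wdens w S) {x y : V} (hx : 0 < bideg w R S x) (hy : 0 < bideg w R S y)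
    (hT : T.Adj x y) : False := by
  have key : ∀ {x y}, 0 < bideg w R S y → T.Adj x y →
      ∃ v, R.Adj y v ∧ S.Adj y v ∧ T.Adj x v := by
    intro x y hy hT
    by_contra hn
    push Not at hn
    refine h.exists_adj_of_bideg hSR hTS (x := x) hy fun z hR hS => ⟨fun hR' => ?_, fun hS' => ?_,
      hn z hR hS⟩
    · exact (h.nr.perms x y z).2.2.2.2.2 hT hR' hS
    · exact (h.nr.perms x y z).2.2.2.2.1 hT hR hS'
  obtain ⟨v, hR, hS, hv⟩ := key hy hT
  obtain ⟨v', hR', hS', hv'⟩ := key hx hT.symm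
  have e1 := (h.bideg_bounds_of_adj hSR hTS hR hS).1
  have e2 := (h.bideg_bounds_of_adj hSR hTS hR' hS').1
  have e3 := h.bideg_add_le_one hv
  have e4 := h.bideg_add_le_one hv'
  linarith

theorem not_adj_or_of_adj (h : IsOpt w R S T) (hSR : wdens w S ≤ wdens w R)
    (hTS : wdens w T ≤ wdens w S) {x a : V} (ha : 0 < bideg w R S a) (hT : T.Adj x a)
    (hRS : R.Adj x a ∨ S.Adj x a) : False := by
  refine h.exists_adj_of_bideg hSR hTS (x := x) ha fun z hR hS => ?_
  obtain ⟨n1, n2, n3, n4, n5, n6⟩ := h.nr.perms x a z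
  exact ⟨fun k => n6 hT k hS, fun k => n5 hT hR k,
    fun k => hRS.elim (fun r => n1 r hS k) fun s => n3 s hR k⟩

/-- Common neighbours of `a` cannot be joined to `x` in `R` or `S`, and those of `c` cannot be
joined to `x` in `T`. As `x` has no `RS`-edge, its normalised degree is at most `(1 − bideg a)/S +
(1 − bideg c)/T`, which is below `3`. -/
theorem not_adj_of_adj (h : IsOpt w R S T) (hSR : wdens w S ≤ wdens w R)
    (hTS : wdens w T ≤ wdens w S) {x a c : V} (hx : ¬ 0 < bideg w R S x)
    (ha : 0 < bideg w R S a) (hc : 0 < bideg w R S c) (hT : T.Adj x a)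
    (hRS : R.Adj x c ∨ S.Adj x c) : False := by
  have b := h.invBounds hSR hTS
  have b3 := b.hab
  have b4 := b.hbc
  have b6 := b.pos_a
  have ha' := h.one_sub_bideg_mul_lt hSR hTS ha
  have hc' := h.one_sub_bideg_mul_lt hSR hTS hc
  have key := h.three_le x (fun z => (1 / wdens w S + 1 / wdens w T) -
    1 / wdens w S * (ind R a z * ind S a z) - 1 / wdens w T * (ind R c z * ind S c z)) ?_
  · have e : ∀ z, w z * ((1 / wdens w S + 1 / wdens w T) -
      1 / wdens w S * (ind R a z * ind S a z) - 1 / wdens w T * (ind R c z * ind S c z)) =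
      w z * (1 / wdens w S + 1 / wdens w T) - 1 / wdens w S * (w z * (ind R a z * ind S a z)) -
      1 / wdens w T * (w z * (ind R c z * ind S c z)) := fun z => by ring
    simp only [e, Finset.sum_sub_distrib, h.sum_mul_const, ← Finset.mul_sum] at key
    change 3 ≤ _ - _ * bideg w R S a - _ * bideg w R S c at key
    have k1 := b.pos_b
    have k2 := b.pos_c
    rcases le_total (bideg w R S a) (bideg w R S c) with hac | hac
    · nlinarith [mul_le_mul_of_nonneg_left hac k2.le]
    · nlinarith [mul_le_mul_of_nonneg_left hac k1.le]
  · intro z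
    obtain ⟨n1, n2, n3, n4, n5, n6⟩ := h.nr.perms x a z
    obtain ⟨k1, k2, k3, k4, k5, k6⟩ := h.nr.perms x c z
    have j : R.Adj c z → S.Adj c z → ¬ T.Adj x z := fun p q t =>
      hRS.elim (fun r => k1 r q t) fun s => k3 s p t
    have m1 : R.Adj x z → ¬ S.Adj x z := fun r s => hx (h.bideg_pos r s)
    generalize 1 / wdens w R = l1 at *
    generalize 1 / wdens w S = l2 at *
    generalize 1 / wdens w T = l3 at *
    unfold ind
    split_ifs <;> first | exact (n6 hT ‹_› ‹_›).elim | exact (n5 hT ‹_› ‹_›).elim |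
      exact (j ‹_› ‹_› ‹_›).elim | exact (m1 ‹_› ‹_›).elim | linarith

open Classical in
/-- Indicator of the vertices incident to edges in both `R` and `S`. -/
noncomputable def _root_.biInd (w : V → ℝ) (R S : SimpleGraph V) (x : V) : ℝ :=
  if 0 < bideg w R S x then 1 else 0

/-- Pairs inside `A` or inside its complement carry at most two colours, pairs across at most one.
-/
theorem sum_le (h : IsOpt w R S T) (hSR : wdens w S ≤ wdens w R)
    (hTS : wdens w T ≤ wdens w S) : wdens w R + wdens w S + wdens w T ≤
      1 + (∑ x, w x * biInd w R S x) ^ 2 + (1 - ∑ x, w x * biInd w R S x) ^ 2 := by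
  have e1 : 1 - ∑ x, w x * biInd w R S x = ∑ x, w x * (1 - biInd w R S x) := by
    simp only [mul_sub, mul_one, Finset.sum_sub_distrib, h.sum]
  have e2 : (1 : ℝ) = ∑ x, ∑ y, w x * w y := by rw [sum_sum_mul, h.sum, one_mul]
  rw [e1, sq, sq, Finset.sum_mul_sum, Finset.sum_mul_sum]
  nth_rewrite 1 [e2]
  simp only [wdens_eq, ← Finset.sum_add_distrib]
  refine Finset.sum_le_sum fun x _ => Finset.sum_le_sum fun y _ => ?_
  have m1 := fun a b c => h.no_tri hSR hTS (x := x) (y := y) a b c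
  have m2 := fun a b c => h.not_adj_of_bideg_pos hSR hTS (x := x) (y := y) a b c
  have m3 := fun a b c => h.not_adj_or_of_adj hSR hTS (x := x) (a := y) a b c
  have m4 := fun a b c => h.not_adj_or_of_adj hSR hTS (x := y) (a := x) a b c
  have m5 := fun a b => h.bideg_pos (x := x) (y := y) a b
  have m6 := fun (a : R.Adj x y) (b : S.Adj x y) => h.bideg_pos (x := y) (y := x) a.symm b.symm
  rw [R.adj_comm, S.adj_comm, T.adj_comm] at m4
  have hxy := mul_nonneg (h.nonneg x) (h.nonneg y)
  suffices hs : ind R x y + ind S x y + ind T x y ≤ 1 + biInd w R S x * biInd w R S y +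
      (1 - biInd w R S x) * (1 - biInd w R S y) by
    nlinarith [mul_le_mul_of_nonneg_left hs hxy]
  unfold ind biInd
  split_ifs <;> first | exact (m1 ‹_› ‹_› ‹_›).elim | exact (m2 ‹_› ‹_› ‹_›).elim |
    exact (m3 ‹_› ‹_› (.inl ‹_›)).elim | exact (m3 ‹_› ‹_› (.inr ‹_›)).elim |
    exact (m4 ‹_› ‹_› (.inl ‹_›)).elim | exact (m4 ‹_› ‹_› (.inr ‹_›)).elim |
    exact absurd (m5 ‹_› ‹_›) ‹_› | exact absurd (m6 ‹_› ‹_›) ‹_› | norm_num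

theorem sum_biInd_le_one (h : IsOpt w R S T) : ∑ x, w x * biInd w R S x ≤ 1 := by
  rw [← h.sum]
  refine Finset.sum_le_sum fun x _ => mul_le_of_le_one_right (h.nonneg x) ?_
  unfold biInd
  split_ifs <;> norm_num

theorem le_sum_biInd (h : IsOpt w R S T) (hSR : wdens w S ≤ wdens w R)
    (hTS : wdens w T ≤ wdens w S) : 7418 / 10000 ≤ ∑ x, w x * biInd w R S x := by
  have hT0 : 0 < wdens w T := by linarith [h.lowT]
  have hS0 : 0 < wdens w S := by linarith
  have hR0 : 0 < wdens w R := by linarith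
  -- The arithmetic–geometric mean inequality, since `3 · 0.1567^(1/3) > 1.617`.
  have hsum : 1617 / 1000 ≤ wdens w R + wdens w S + wdens w T := by
    by_contra hlt
    push Not at hlt
    have h3 : (wdens w R + wdens w S + wdens w T) ^ 3 ≤ (1617 / 1000) ^ 3 :=
      pow_le_pow_left₀ (by positivity) hlt.le 3
    have hp := h.prod
    generalize wdens w R = r at *
    generalize wdens w S = s at *
    generalize wdens w T = t at *
    have := mul_nonneg hR0.le (sq_nonneg (s - t))
    have := mul_nonneg hS0.le (sq_nonneg (r - t))
    have := mul_nonneg hT0.le (sq_nonneg (r - s))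
    have := mul_nonneg (add_pos (add_pos hR0 hS0) hT0).le (add_nonneg (add_nonneg
      (sq_nonneg (s - t)) (sq_nonneg (r - t))) (sq_nonneg (r - s)))
    nlinarith
  have hRS : 1 < wdens w R + wdens w S := by linarith
  obtain ⟨x, hx⟩ := h.exists_le_bideg
  obtain ⟨y, hR, hS⟩ := exists_adj_of_bideg_pos (by linarith : 0 < bideg w R S x)
  have hle : ∀ x, bideg w R S x ≤ ∑ x, w x * biInd w R S x := by
    intro x
    refine Finset.sum_le_sum fun z _ => mul_le_mul_of_nonneg_left ?_ (h.nonneg z)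
    have m := fun (a : R.Adj x z) (b : S.Adj x z) => h.bideg_pos (x := z) (y := x) a.symm b.symm
    unfold ind biInd
    split_ifs <;> first | exact absurd (m ‹_› ‹_›) ‹_› | norm_num
  have k1 := (h.bideg_bounds_of_adj hSR hTS hR hS).1
  have k2 := hle x
  have k3 := hle y
  have k4 := h.sum_le hSR hTS
  generalize ∑ x, w x * biInd w R S x = a at *
  -- `k1`, `k2` and `k3` give `a > 1/2`, and `a² + (1 − a)² ≥ 0.617` then forces the larger root.
  nlinarith

/-- One such edge forbids all `T`-edges from `x` to `A` by `not_adj_of_adj`. As `x` has no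
`RS`-edge, its normalised degree is at most `1/S + (1 − m)/T`, which is below `3`. -/
theorem not_adj_of_bideg_pos_of_not (h : IsOpt w R S T) (hSR : wdens w S ≤ wdens w R)
    (hTS : wdens w T ≤ wdens w S) {x a : V} (hx : ¬ 0 < bideg w R S x)
    (ha : 0 < bideg w R S a) (hRS : R.Adj x a ∨ S.Adj x a) : False := by
  have b := h.invBounds hSR hTS
  have b3 := b.hab
  have b4 := b.hbc
  have b6 := b.pos_a
  have key := h.three_le x (fun z => (1 / wdens w S + 1 / wdens w T) -
    1 / wdens w T * biInd w R S z) ?_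
  · have e : ∀ z, w z * ((1 / wdens w S + 1 / wdens w T) - 1 / wdens w T * biInd w R S z) =
      w z * (1 / wdens w S + 1 / wdens w T) - 1 / wdens w T * (w z * biInd w R S z) :=
      fun z => by ring
    simp only [e, Finset.sum_sub_distrib, h.sum_mul_const, ← Finset.mul_sum] at key
    have k1 := h.le_sum_biInd hSR hTS
    have k2 := b.add_mul_lt (h.inv_lt hSR hTS)
    nlinarith [mul_le_mul_of_nonneg_left k1 b.pos_c.le]
  · intro z
    have m1 : R.Adj x z → ¬ S.Adj x z := fun r s => hx (h.bideg_pos r s)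
    have m2 := fun c t => h.not_adj_of_adj hSR hTS (a := z) hx c ha t hRS
    generalize 1 / wdens w R = l1 at *
    generalize 1 / wdens w S = l2 at *
    generalize 1 / wdens w T = l3 at *
    unfold ind biInd
    split_ifs <;> first | exact (m1 ‹_› ‹_›).elim | exact (m2 ‹_› ‹_›).elim | linarith

theorem prod_le (h : IsOpt w R S T) (hSR : wdens w S ≤ wdens w R)
    (hTS : wdens w T ≤ wdens w S) : ∃ m ∈ Set.Icc (0 : ℝ) 1,
      wdens w R * wdens w S * wdens w T ≤ hFun m := by
  set m := ∑ x, w x * biInd w R S x with hm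
  have hm0 : 7418 / 10000 ≤ m := h.le_sum_biInd hSR hTS
  have hm1 : m ≤ 1 := h.sum_biInd_le_one
  refine ⟨m, ⟨by linarith, hm1⟩, ?_⟩
  set u : V → ℝ := fun x => w x * (1 - biInd w R S x) with hu
  have hbi : ∀ x, biInd w R S x ≤ 1 := fun x => by unfold biInd; split_ifs <;> norm_num
  have hu0 : ∀ x, 0 ≤ u x := fun x => mul_nonneg (h.nonneg x) (sub_nonneg.2 (hbi x))
  have hus : ∑ x, u x = 1 - m := by
    simp only [hu, hm, mul_sub, mul_one, Finset.sum_sub_distrib, h.sum]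
  have hRS : ∀ (Q : SimpleGraph V), (∀ x a, ¬ 0 < bideg w R S x → 0 < bideg w R S a →
      ¬ Q.Adj x a) → wdens w Q ≤ m ^ 2 + wdens u Q := by
    intro Q hQ
    rw [hm, sq, Finset.sum_mul_sum, wdens_eq, wdens_eq, ← Finset.sum_add_distrib]
    refine Finset.sum_le_sum fun x _ => ?_
    rw [← Finset.sum_add_distrib]
    refine Finset.sum_le_sum fun y _ => ?_
    have m1 := hQ x y
    have m2 := hQ y x
    rw [Q.adj_comm] at m2
    have hxy := mul_nonneg (h.nonneg x) (h.nonneg y)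
    simp only [hu]
    unfold ind biInd
    split_ifs <;> first | exact (m1 ‹_› ‹_› ‹_›).elim | exact (m2 ‹_› ‹_› ‹_›).elim | nlinarith
  have lR := hRS R fun x a hx ha hxa => h.not_adj_of_bideg_pos_of_not hSR hTS hx ha (.inl hxa)
  have lS := hRS S fun x a hx ha hxa => h.not_adj_of_bideg_pos_of_not hSR hTS hx ha (.inr hxa)
  have lT : wdens w T ≤ 2 * m * (1 - m) + wdens u T := by
    have e : 2 * m * (1 - m) = m * (1 - m) + (1 - m) * m := by ring
    rw [e, ← hus, hm, Finset.sum_mul_sum, Finset.sum_mul_sum, wdens_eq, wdens_eq,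
      ← Finset.sum_add_distrib, ← Finset.sum_add_distrib]
    refine Finset.sum_le_sum fun x _ => ?_
    rw [← Finset.sum_add_distrib, ← Finset.sum_add_distrib]
    refine Finset.sum_le_sum fun y _ => ?_
    have m1 := fun a b c => h.not_adj_of_bideg_pos hSR hTS (x := x) (y := y) a b c
    have hxy := mul_nonneg (h.nonneg x) (h.nonneg y)
    simp only [hu]
    unfold ind biInd
    split_ifs <;> first | exact (m1 ‹_› ‹_› ‹_›).elim | nlinarith
  have hT0 : 0 < wdens w T := by linarith [h.lowT]
  have hS0 : 0 < wdens w S := by linarith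
  have hR0 : 0 < wdens w R := by linarith
  obtain ⟨r, s, t, ht0, ht1, h2, hrs, er, es, et⟩ : ∃ r s t : ℝ, 0 ≤ t ∧ t ≤ 1 ∧ r + s + t ≤ 2 ∧
      r * s ≤ 3 * (1 - t) + 2 * (2 - r - s - t) ∧ wdens u R = (1 - m) ^ 2 * r ∧
      wdens u S = (1 - m) ^ 2 * s ∧ wdens u T = (1 - m) ^ 2 * t := by
    -- If `A` has full weight, nothing is left to rescale and `r = s = t = 0` serves.
    rcases hm1.eq_or_lt with h1 | h1
    · have hz : ∀ x, u x = 0 := fun x =>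
        (Finset.sum_eq_zero_iff_of_nonneg fun x _ => hu0 x).1 (by rw [hus, h1, sub_self]) x
          (Finset.mem_univ x)
      refine ⟨0, 0, 0, le_rfl, by norm_num, by norm_num, by norm_num, ?_, ?_, ?_⟩ <;>
        simp [wdens, hz]
    · have hy : 0 < 1 - m := by linarith
      set v : V → ℝ := fun x => (1 - m)⁻¹ * u x with hv
      have hv0 : ∀ x, 0 ≤ v x := fun x => mul_nonneg (inv_pos.2 hy).le (hu0 x)
      have hv1 : ∑ x, v x = 1 := by
        rw [hv, ← Finset.mul_sum, hus, inv_mul_cancel₀ hy.ne']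
      have ev : ∀ Q : SimpleGraph V, wdens u Q = (1 - m) ^ 2 * wdens v Q := fun Q => by
        rw [hv, wdens_smul, ← mul_assoc, ← mul_pow, mul_inv_cancel₀ hy.ne', one_pow, one_mul]
      have hv2 : wdens v R + wdens v S + wdens v T ≤ 2 := by
        have e2 : (2 : ℝ) = ∑ x, ∑ y, v x * v y * 2 := by
          simp only [← Finset.sum_mul, sum_sum_mul, hv1]; norm_num
        rw [e2]
        simp only [wdens_eq, ← Finset.sum_add_distrib]
        refine Finset.sum_le_sum fun x _ => Finset.sum_le_sum fun y _ => ?_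
        have m1 := fun a b c => h.no_tri hSR hTS (x := x) (y := y) a b c
        rw [← mul_add, ← mul_add]
        refine mul_le_mul_of_nonneg_left ?_ (mul_nonneg (hv0 x) (hv0 y))
        unfold ind
        split_ifs <;> first | exact (m1 ‹_› ‹_› ‹_›).elim | norm_num
      exact ⟨_, _, _, wdens_nonneg hv0 T, wdens_le_one hv0 hv1 T, hv2,
        wdens_mul_wdens_le h.nr hv0 hv1 hv2, ev R, ev S, ev T⟩
  rw [er] at lR
  rw [es] at lS
  rw [et] at lT
  refine le_trans ?_ (prod_le_hFun hm0 hm1 ht0 ht1 h2 hrs)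
  exact mul_le_mul (mul_le_mul lR lS hS0.le (hR0.le.trans lR)) lT hT0.le
    (mul_nonneg (hR0.le.trans lR) (hS0.le.trans lS))

/-- The product of the densities of an optimal template is at most `h(υ)`. -/
theorem prod_le_upsilon (h : IsOpt w R S T) :
    wdens w R * wdens w S * wdens w T ≤ hFun upsilon := by
  have key : ∀ {R S T : SimpleGraph V}, IsOpt w R S T → wdens w S ≤ wdens w R →
      wdens w T ≤ wdens w S → wdens w R * wdens w S * wdens w T ≤ hFun upsilon := by
    intro R S T h h1 h2
    obtain ⟨m, hm, hle⟩ := h.prod_le h1 h2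
    exact hle.trans (upsilon_spec.2 hm)
  rcases le_total (wdens w S) (wdens w R) with h1 | h1 <;>
  rcases le_total (wdens w T) (wdens w S) with h2 | h2 <;>
  rcases le_total (wdens w T) (wdens w R) with h3 | h3
  · exact key h h1 h2
  · exact key h h1 h2
  · linarith [key h.swap23 h3 h2]
  · linarith [key h.swap23.swap12 h3 h1]
  · linarith [key h.swap12 h1 h3]
  · linarith [key h.swap12.swap23 h2 h3]
  · linarith [key h.swap12.swap23.swap12 h2 h1]
  · linarith [key h.swap12.swap23.swap12 h2 h1]

end IsOpt

/-! ### First-order conditions at a maximum -/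

/-- The derivative at `t = 0` of the product when weight `t` is moved to one vertex, whose degrees
are `x, y, z`. There is no `t²` term because graphs have no loops. The product divided by `abc` is
`1 + t g(t)`, and `g 0 = 2 (x/a + y/b + z/c) − 6`. -/
theorem sum_div_le_three {a b c x y z : ℝ} (ha : 0 < a) (hb : 0 < b) (hc : 0 < c)
    (h : ∀ t : ℝ, 0 < t → t < 1 → ((1 - t) ^ 2 * a + 2 * t * (1 - t) * x) *
      ((1 - t) ^ 2 * b + 2 * t * (1 - t) * y) * ((1 - t) ^ 2 * c + 2 * t * (1 - t) * z) ≤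
        a * b * c) : x / a + y / b + z / c ≤ 3 := by
  obtain ⟨p, rfl⟩ : ∃ p, x = p * a := ⟨x / a, by field_simp⟩
  obtain ⟨q, rfl⟩ : ∃ q, y = q * b := ⟨y / b, by field_simp⟩
  obtain ⟨r, rfl⟩ : ∃ r, z = r * c := ⟨z / c, by field_simp⟩
  rw [mul_div_cancel_right₀ _ ha.ne', mul_div_cancel_right₀ _ hb.ne',
    mul_div_cancel_right₀ _ hc.ne']
  let e : ℝ → ℝ := fun t => (2 * p - 1 + (2 * q - 1) + (2 * r - 1)) +
    ((2 * p - 1) * (2 * q - 1) + (2 * p - 1) * (2 * r - 1) + (2 * q - 1) * (2 * r - 1)) * t +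
    (2 * p - 1) * (2 * q - 1) * (2 * r - 1) * t ^ 2
  let g : ℝ → ℝ := fun t => (-3 + 3 * t - t ^ 2) + e t + t * (-3 + 3 * t - t ^ 2) * e t
  have hg : ∀ t : ℝ, 0 < t → t < 1 → g t ≤ 0 := by
    intro t ht ht1
    have h1 := h t ht ht1
    have e1 : ((1 - t) ^ 2 * a + 2 * t * (1 - t) * (p * a)) *
      ((1 - t) ^ 2 * b + 2 * t * (1 - t) * (q * b)) *
      ((1 - t) ^ 2 * c + 2 * t * (1 - t) * (r * c)) = (a * b * c) * (1 + t * g t) := by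
      simp only [g, e]; ring
    rw [e1] at h1
    have h2 : a * b * c * (t * g t) ≤ 0 := by linarith
    by_contra hn
    push Not at hn
    have : 0 < a * b * c * (t * g t) := by positivity
    linarith
  have hcont : Continuous g := by simp only [g, e]; fun_prop
  have hlim : Filter.Tendsto g (nhdsWithin 0 (Set.Ioi 0)) (nhds (g 0)) :=
    hcont.continuousAt.tendsto.mono_left nhdsWithin_le_nhds
  have h0 : g 0 ≤ 0 := le_of_tendsto hlim <| by
    filter_upwards [Ioo_mem_nhdsGT (zero_lt_one (α := ℝ))] with t ht using hg t ht.1 ht.2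
  simp only [g, e] at h0
  linarith

theorem wdens_add_single {V : Type*} [Fintype V] [DecidableEq V] (w : V → ℝ) (R : SimpleGraph V)
    (u : V) (t : ℝ) : wdens (fun x => (1 - t) * w x + t * (if x = u then 1 else 0)) R =
      (1 - t) ^ 2 * wdens w R + 2 * t * (1 - t) * wdeg w R u := by
  have h1 : ∀ x, wdeg (fun x => (1 - t) * w x + t * (if x = u then 1 else 0)) R x =
      (1 - t) * wdeg w R x + t * ind R x u := by
    intro x
    simp only [wdeg, add_mul, Finset.sum_add_distrib, mul_assoc, ← Finset.mul_sum, ite_mul, one_mul,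
      zero_mul, Finset.sum_ite_eq', Finset.mem_univ, if_true]
  have h2 : ∑ x, w x * ind R x u = wdeg w R u :=
    Finset.sum_congr rfl fun x _ => by rw [ind_comm]
  have h3 : ∀ x, ((1 - t) * w x + t * (if x = u then 1 else 0)) *
      ((1 - t) * wdeg w R x + t * ind R x u) = (1 - t) ^ 2 * (w x * wdeg w R x) +
      t * (1 - t) * (w x * ind R x u) +
      (if x = u then t * (1 - t) * wdeg w R x + t ^ 2 * ind R x u else 0) := by
    intro x
    split_ifs <;> ring
  rw [wdens]
  simp only [h1, h3, Finset.sum_add_distrib, ← Finset.mul_sum, h2, Finset.sum_ite_eq',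
    Finset.mem_univ, if_true, ind_self]
  rw [wdens]
  ring

theorem continuous_wdens {V : Type*} [Fintype V] (R : SimpleGraph V) :
    Continuous fun w : V → ℝ => wdens w R := by
  simp only [wdens, wdeg]
  fun_prop

/-- At optimal weights no vertex has weighted degree above average. -/
theorem sum_wdeg_div_le_three {V : Type*} [Fintype V] {w : V → ℝ} {R S T : SimpleGraph V}
    (hw : w ∈ stdSimplex ℝ V)
    (hmax : IsMaxOn (fun w => wdens w R * wdens w S * wdens w T) (stdSimplex ℝ V) w)
    (hR : 0 < wdens w R) (hS : 0 < wdens w S) (hT : 0 < wdens w T) (u : V) :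
    wdeg w R u / wdens w R + wdeg w S u / wdens w S + wdeg w T u / wdens w T ≤ 3 := by
  classical
  refine sum_div_le_three hR hS hT fun t ht0 ht1 => ?_
  have hmem : (fun x => (1 - t) * w x + t * (if x = u then 1 else 0)) ∈ stdSimplex ℝ V := by
    refine ⟨fun x => ?_, ?_⟩
    · have := hw.1 x
      have : 0 ≤ 1 - t := by linarith
      change 0 ≤ (1 - t) * w x + t * (if x = u then 1 else 0)
      split_ifs <;> positivity
    · simp only [Finset.sum_add_distrib, ← Finset.mul_sum, hw.2]
      simp
  have h := isMaxOn_iff.1 hmax _ hmem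
  simpa only [wdens_add_single] using h

/-- At optimal weights every vertex in the support has average weighted degree. -/
theorem sum_wdeg_div_eq_three {V : Type*} [Fintype V] {w : V → ℝ} {R S T : SimpleGraph V}
    (hw : w ∈ stdSimplex ℝ V)
    (hmax : IsMaxOn (fun w => wdens w R * wdens w S * wdens w T) (stdSimplex ℝ V) w)
    (hR : 0 < wdens w R) (hS : 0 < wdens w S) (hT : 0 < wdens w T) {u : V} (hu : 0 < w u) :
    wdeg w R u / wdens w R + wdeg w S u / wdens w S + wdeg w T u / wdens w T = 3 := by
  have hle := sum_wdeg_div_le_three hw hmax hR hS hT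
  have hsum : ∑ x, w x * (3 - (wdeg w R x / wdens w R + wdeg w S x / wdens w S +
      wdeg w T x / wdens w T)) = 0 := by
    have e : ∀ x, w x * (3 - (wdeg w R x / wdens w R + wdeg w S x / wdens w S +
      wdeg w T x / wdens w T)) = w x * 3 - w x * wdeg w R x / wdens w R -
      w x * wdeg w S x / wdens w S - w x * wdeg w T x / wdens w T := fun x => by ring
    simp only [e, Finset.sum_sub_distrib, ← Finset.sum_mul, ← Finset.sum_div, hw.2]
    change 1 * 3 - wdens w R / wdens w R - wdens w S / wdens w S - wdens w T / wdens w T = 0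
    rw [div_self hR.ne', div_self hS.ne', div_self hT.ne']
    norm_num
  have := (Finset.sum_eq_zero_iff_of_nonneg fun x _ =>
    mul_nonneg (hw.1 x) (sub_nonneg.2 (hle x))).1 hsum u (Finset.mem_univ u)
  rcases mul_eq_zero.1 this with h | h
  · exact absurd h hu.ne'
  · linarith

/-! ### Adding a vertex -/

/-- Add a vertex joined to all vertices if `b` holds, and to none otherwise. -/
def SimpleGraph.addVertex {V : Type*} (R : SimpleGraph V) (b : Prop) : SimpleGraph (Option V) where
  Adj
    | some x, some y => R.Adj x y
    | none, none => False
    | some _, none => b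
    | none, some _ => b
  symm := ⟨by rintro (_ | x) (_ | y) h <;> first | exact h | exact SimpleGraph.Adj.symm h⟩
  loopless := ⟨by rintro (_ | x) h <;> first | exact h | exact R.loopless.irrefl x h⟩

theorem NoRainbow.addVertex {V : Type*} {R S T : SimpleGraph V} (h : NoRainbow R S T) :
    NoRainbow (R.addVertex False) (S.addVertex False) (T.addVertex True) := by
  rintro (_ | x) (_ | y) (_ | z) h1 h2 h3
  all_goals first | exact h1 | exact h2 | exact h3 | exact h x y z h1 h2 h3

open Classical in
theorem wdens_addVertex {V : Type*} [Fintype V] {w : V → ℝ} (h1 : ∑ x, w x = 1)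
    (R : SimpleGraph V) (b : Prop) (t : ℝ) :
    wdens (fun x : Option V => x.elim t fun x => (1 - t) * w x) (R.addVertex b) =
      (1 - t) ^ 2 * wdens w R + 2 * t * (1 - t) * (if b then 1 else 0) := by
  have e1 : ∀ x y, ind (R.addVertex b) (some x) (some y) = ind R x y := fun x y => rfl
  have e2 : ∀ x, ind (R.addVertex b) (some x) none = if b then 1 else 0 := fun x => rfl
  have e3 : ∀ x, ind (R.addVertex b) none (some x) = if b then 1 else 0 := fun x => rfl
  have e4 : ind (R.addVertex b) none none = 0 := ind_self _ _
  simp only [wdens, wdeg, Fintype.sum_option, Option.elim_none, Option.elim_some, e1, e2, e3, e4,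
    mul_zero, zero_add, ← Finset.sum_mul, ← Finset.mul_sum, h1, mul_assoc, mul_add,
    Finset.sum_add_distrib]
  have : ∀ x, w x * ((1 - t) * ∑ y, w y * ind R x y) = (1 - t) * (w x * ∑ y, w y * ind R x y) :=
    fun x => by ring
  simp only [this, ← Finset.mul_sum]
  ring

/-! ### The supremum over all weighted templates -/

/-- The products of the densities of weighted templates without rainbow triangles. -/
def densityProducts : Set ℝ :=
  {v | ∃ (V : Type u) (_ : Fintype V) (w : V → ℝ) (R S T : SimpleGraph V),
    w ∈ stdSimplex ℝ V ∧ NoRainbow R S T ∧ v = wdens w R * wdens w S * wdens w T}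

theorem le_one_of_mem_densityProducts {v : ℝ} (hv : v ∈ densityProducts.{u}) : v ≤ 1 := by
  obtain ⟨V, _, w, R, S, T, hw, -, rfl⟩ := hv
  have a := wdens_le_one hw.1 hw.2
  have b := wdens_nonneg hw.1
  exact mul_le_one₀ (mul_le_one₀ (a R) (b S) (a S)) (b T) (a T)

/-- A new vertex of weight `t`, joined to everything in colour `T` only, multiplies the product by
about `1 + t (2/wdens w T − 6)`. If the density were below `1000/3001`, then `t = 4/10⁵` would gain
more than the slack `1/10⁸`, even after the terms of order `t²`. -/
theorem le_wdens_of_near_max {V : Type u} [Fintype V] {w : V → ℝ} {R S T : SimpleGraph V}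
    (hw : w ∈ stdSimplex ℝ V) (h : NoRainbow R S T) {M : ℝ} (hM : ∀ v ∈ densityProducts.{u}, v ≤ M)
    (hpos : 0 < wdens w R * wdens w S * wdens w T)
    (hnear : M * (1 - 1 / 10 ^ 8) < wdens w R * wdens w S * wdens w T) :
    1000 / 3001 ≤ wdens w T := by
  classical
  by_contra hlt
  push Not at hlt
  set t : ℝ := 4 / 10 ^ 5 with ht
  have hmem : (fun x : Option V => x.elim t fun x => (1 - t) * w x) ∈ stdSimplex ℝ (Option V) := by
    refine ⟨?_, ?_⟩
    · rintro (_ | x)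
      · simp only [Option.elim_none, ht]; norm_num
      · exact mul_nonneg (by rw [ht]; norm_num) (hw.1 x)
    · rw [Fintype.sum_option]
      simp only [Option.elim_none, Option.elim_some, ← Finset.mul_sum, hw.2]
      ring
  have key := hM _ ⟨Option V, inferInstance, _, _, _, _, hmem, h.addVertex, rfl⟩
  simp only [wdens_addVertex hw.2, if_true, if_false] at key
  have b := wdens_nonneg hw.1
  have hRS : 0 ≤ wdens w R * wdens w S := mul_nonneg (b R) (b S)
  have k1 : wdens w R * wdens w S * wdens w T * 3001 ≤ wdens w R * wdens w S * 1000 := by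
    nlinarith
  norm_num [ht] at key hnear
  nlinarith

theorem sum_subtype_pos {V : Type*} [Fintype V] {w : V → ℝ} (hw : ∀ x, 0 ≤ w x)
    [Fintype {x // 0 < w x}] (f : V → ℝ) :
    ∑ x : {x // 0 < w x}, w x * f x = ∑ x, w x * f x := by
  classical
  rw [← Finset.sum_filter_of_ne (p := fun x => 0 < w x) (s := Finset.univ)
    (f := fun x => w x * f x)]
  · rw [← Finset.sum_subtype_eq_sum_filter, Finset.subtype_univ]
  · intro x _ hx
    exact lt_of_le_of_ne (hw x) fun h0 => hx (by rw [← h0, zero_mul])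

theorem le_upsilon_of_mem_densityProducts {v : ℝ} (hv : v ∈ densityProducts.{u}) :
    v ≤ hFun upsilon := by
  classical
  by_contra hlt
  push Not at hlt
  have hbdd : BddAbove densityProducts.{u} := ⟨1, fun v hv => le_one_of_mem_densityProducts hv⟩
  set M := sSup densityProducts.{u} with hMd
  have hM : ∀ v ∈ densityProducts.{u}, v ≤ M := fun v hv => le_csSup hbdd hv
  have hups : 1567 / 10000 ≤ hFun upsilon := by
    have h1 : hFun (79 / 100) ≤ hFun upsilon :=
      upsilon_spec.2 (show (79 / 100 : ℝ) ∈ Set.Icc (0 : ℝ) 1 by constructor <;> norm_num)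
    refine le_trans ?_ h1
    norm_num [hFun]
  have hvM := hM v hv
  obtain ⟨v', ⟨V, _, w₀, R, S, T, hw₀, hnr, rfl⟩, hv'⟩ :=
    exists_lt_of_lt_csSup ⟨v, hv⟩ (show max (hFun upsilon) (M * (1 - 1 / 10 ^ 8)) < M from
      max_lt (by linarith) (by nlinarith))
  obtain ⟨w, hw, hmax⟩ := (isCompact_stdSimplex ℝ V).exists_isMaxOn ⟨w₀, hw₀⟩
    (((continuous_wdens R).mul (continuous_wdens S)).mul (continuous_wdens T)).continuousOn
  have hle : wdens w₀ R * wdens w₀ S * wdens w₀ T ≤ wdens w R * wdens w S * wdens w T :=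
    hmax hw₀
  have hgt := lt_of_lt_of_le (lt_of_le_of_lt (le_max_left _ _) hv') hle
  have hnear := lt_of_lt_of_le (lt_of_le_of_lt (le_max_right _ _) hv') hle
  have hpos : 0 < wdens w R * wdens w S * wdens w T := by linarith
  have lT := le_wdens_of_near_max hw hnr hM hpos hnear
  have lS := le_wdens_of_near_max hw hnr.swap23 hM (by rwa [mul_right_comm])
    (by rwa [mul_right_comm (wdens w R)])
  have lR := le_wdens_of_near_max hw hnr.swap12.swap23 hM
    (by rwa [mul_right_comm, mul_comm (wdens w S)])
    (by rwa [mul_right_comm (wdens w S), mul_comm (wdens w S)])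
  have hR : 0 < wdens w R := by linarith
  have hS : 0 < wdens w S := by linarith
  have hT : 0 < wdens w T := by linarith
  have hdeg : ∀ (Q : SimpleGraph V) (x : {x // 0 < w x}),
      wdeg (fun x : {x // 0 < w x} => w x) (Q.comap Subtype.val) x = wdeg w Q x :=
    fun Q x => sum_subtype_pos hw.1 fun y => ind Q x y
  have hdens : ∀ Q : SimpleGraph V,
      wdens (fun x : {x // 0 < w x} => w x) (Q.comap Subtype.val) = wdens w Q := by
    intro Q
    rw [wdens, wdens, ← sum_subtype_pos hw.1]
    simp only [hdeg]
  have hopt : IsOpt (fun x : {x // 0 < w x} => w x) (R.comap Subtype.val) (S.comap Subtype.val)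
      (T.comap Subtype.val) := by
    refine ⟨fun x => x.2, ?_, fun x y z h1 h2 h3 => hnr x y z h1 h2 h3, fun x => ?_, ?_, ?_, ?_, ?_⟩
    · have := sum_subtype_pos hw.1 fun _ => 1
      simpa only [mul_one, hw.2] using this
    · simp only [hdeg, hdens]
      exact sum_wdeg_div_eq_three hw hmax hR hS hT x.2
    all_goals simp only [hdens]
    · exact lR
    · exact lS
    · exact lT
    · linarith
  have := hopt.prod_le_upsilon
  simp only [hdens] at this
  linarith

/-! ### Passing from templates to weighted templates -/

theorem ColouringTemplate.IsGallai.noRainbow {V : Type*} {G : ColouringTemplate 3 V}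
    (hG : G.IsGallai) : NoRainbow (G 0) (G 1) (G 2) := by
  intro x y z h1 h2 h3
  -- Modulo `3`, `1 − (a + b)` gives the edges `01`, `12`, `02` the colours `0`, `1`, `2`.
  refine hG ⟨fun e => Sym2.lift ⟨fun a b : Fin 3 => 1 - (a + b), fun a b => congrArg (1 - ·) (add_comm a b)⟩ e.1,
    ?_, ![x, y, z], ?_, ?_⟩
  · rintro ⟨e, he⟩ ⟨e', he'⟩ h
    induction e using Sym2.ind with | _ a b =>
    induction e' using Sym2.ind with | _ c d =>
    have key : ∀ a b c d : Fin 3, a ≠ b → c ≠ d → 1 - (a + b) = 1 - (c + d) →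
      s(a, b) = s(c, d) := by decide
    exact Subtype.ext (key a b c d he he' h)
  · have hxy := h1.ne
    have hyz := h2.ne
    have hxz := h3.ne
    intro a b hab
    fin_cases a <;> fin_cases b <;> simp_all
  · intro a b hab
    change (G (1 - (a + b))).Adj _ _
    fin_cases a <;> fin_cases b
    · exact absurd rfl hab
    · exact h1
    · exact h3
    · exact h1.symm
    · exact absurd rfl hab
    · exact h2
    · exact h3.symm
    · exact h2.symm
    · exact absurd rfl hab

theorem wdens_const {V : Type*} [Fintype V] (R : SimpleGraph V) (c : ℝ) :
    wdens (fun _ => c) R = c ^ 2 * (2 * (R.edgeSet.ncard : ℝ)) := by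
  classical
  have h1 : ∀ x, ∑ y, ind R x y = (R.degree x : ℝ) := by
    intro x
    simp only [ind, Finset.sum_boole]
    rw [← SimpleGraph.card_neighborFinset_eq_degree, SimpleGraph.neighborFinset_eq_filter]
  have h2 : (∑ x, (R.degree x : ℝ)) = 2 * (R.edgeSet.ncard : ℝ) := by
    rw [← R.coe_edgeFinset, Set.ncard_coe_finset]
    exact_mod_cast R.sum_degrees_eq_twice_card_edges
  simp only [wdens, wdeg, ← Finset.mul_sum, h1, h2]
  ring

theorem prod_ncard_edgeSet_le {V : Type u} [Fintype V] {G : ColouringTemplate 3 V}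
    (hG : G.IsGallai) : ((G 0).edgeSet.ncard : ℝ) * ((G 1).edgeSet.ncard : ℝ) *
      ((G 2).edgeSet.ncard : ℝ) * 8 ≤ hFun upsilon * (Fintype.card V : ℝ) ^ 6 := by
  rcases isEmpty_or_nonempty V with hV | hV
  · have : (G 0).edgeSet.ncard = 0 := by
      have : (G 0).edgeSet = ∅ := by rw [Subsingleton.elim (G 0) ⊥, SimpleGraph.edgeSet_bot]
      rw [this, Set.ncard_empty]
    simp [this]
  · set n : ℝ := (Fintype.card V : ℝ) with hn
    have hn0 : 0 < n := by rw [hn]; exact_mod_cast Fintype.card_pos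
    have key := le_upsilon_of_mem_densityProducts ⟨V, inferInstance, fun _ => n⁻¹, _, _, _,
      ⟨fun _ => (inv_pos.2 hn0).le, by
        rw [Finset.sum_const, Finset.card_univ, nsmul_eq_mul, ← hn, mul_inv_cancel₀ hn0.ne']⟩,
      hG.noRainbow, rfl⟩
    simp only [wdens_const] at key
    have := mul_le_mul_of_nonneg_right key (show 0 ≤ n ^ 6 by positivity)
    refine le_trans (le_of_eq ?_) this
    field_simp
    ring

theorem mainTheorem2 :
    ∃ ε : ℕ → ℝ, Filter.Tendsto ε Filter.atTop (nhds 0) ∧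
      (∀ n : ℕ, 0 ≤ hFun upsilon + ε n) ∧
      ∀ (n : ℕ) (V : Type u) [Fintype V], Fintype.card V = n →
        ∀ G : ColouringTemplate 3 V, G.IsGallai →
          (((G 0).edgeSet.ncard : ℝ) * ((G 1).edgeSet.ncard : ℝ) *
              ((G 2).edgeSet.ncard : ℝ)) ^ (1 / 3 : ℝ) ≤
            (hFun upsilon + ε n) ^ (1 / 3 : ℝ) * (n.choose 2 : ℝ) := by
  have hups : 0 ≤ hFun upsilon := by
    have h1 : hFun 0 ≤ hFun upsilon :=
      upsilon_spec.2 (show (0 : ℝ) ∈ Set.Icc (0 : ℝ) 1 by constructor <;> norm_num)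
    simpa [hFun] using h1
  have heq : ∀ n : ℕ, hFun upsilon + hFun upsilon * (((n : ℝ) / ((n : ℝ) + -1)) ^ 3 - 1) =
      hFun upsilon * ((n : ℝ) / ((n : ℝ) + -1)) ^ 3 := fun n => by ring
  have hfrac : ∀ n : ℕ, 0 ≤ (n : ℝ) / ((n : ℝ) + -1) := by
    intro n
    rcases Nat.eq_zero_or_pos n with rfl | hn
    · simp
    · have : (1 : ℝ) ≤ n := by exact_mod_cast hn
      exact div_nonneg (by positivity) (by linarith)
  -- The factor `(n/(n − 1))³` converts `n⁶/8` into `(n choose 2)³`. For `n ≤ 1` the quotient is `0`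
  -- (at `n = 1` by division by zero), which is harmless as there are no edges.
  refine ⟨fun n => hFun upsilon * (((n : ℝ) / ((n : ℝ) + -1)) ^ 3 - 1), ?_, ?_, ?_⟩
  · have h1 := ((tendsto_natCast_div_add_atTop (𝕜 := ℝ) (-1)).pow 3).sub_const 1
    simpa using h1.const_mul (hFun upsilon)
  · intro n
    rw [heq]
    exact mul_nonneg hups (pow_nonneg (hfrac n) 3)
  · intro n V _ hcard G hG
    have key := prod_ncard_edgeSet_le hG
    rw [hcard] at key
    rw [heq]
    set E := ((G 0).edgeSet.ncard : ℝ) * ((G 1).edgeSet.ncard : ℝ) * ((G 2).edgeSet.ncard : ℝ)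
    have hE : 0 ≤ E := by positivity
    have hle : E ≤ hFun upsilon * ((n : ℝ) / ((n : ℝ) + -1)) ^ 3 * (n.choose 2 : ℝ) ^ 3 := by
      rcases lt_or_ge n 2 with hn | hn
      · have h0 : (G 0).edgeSet.ncard = 0 := by
          have hs : Subsingleton V := Fintype.card_le_one_iff_subsingleton.1 (by omega)
          have : (G 0).edgeSet = ∅ := by rw [Subsingleton.elim (G 0) ⊥, SimpleGraph.edgeSet_bot]
          rw [this, Set.ncard_empty]
        have hE0 : E = 0 := by simp [E, h0]
        rw [hE0]
        exact mul_nonneg (mul_nonneg hups (pow_nonneg (hfrac n) 3)) (by positivity)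
      · have hn' : (0 : ℝ) < (n : ℝ) + -1 := by
          have : (2 : ℝ) ≤ n := by exact_mod_cast hn
          linarith
        rw [Nat.cast_choose_two]
        have : hFun upsilon * ((n : ℝ) / ((n : ℝ) + -1)) ^ 3 * ((n : ℝ) * ((n : ℝ) - 1) / 2) ^ 3 =
            hFun upsilon * (n : ℝ) ^ 6 / 8 := by
          rw [← sub_eq_add_neg] at hn' ⊢
          field_simp
          ring
        rw [this]
        linarith
    calc E ^ (1 / 3 : ℝ) ≤
        (hFun upsilon * ((n : ℝ) / ((n : ℝ) + -1)) ^ 3 * (n.choose 2 : ℝ) ^ 3) ^ (1 / 3 : ℝ) :=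
          Real.rpow_le_rpow hE hle (by norm_num)
      _ = _ := by
        rw [Real.mul_rpow (mul_nonneg hups (pow_nonneg (hfrac n) 3)) (by positivity)]
        congr 1
        rw [← Real.rpow_natCast, ← Real.rpow_mul (by positivity)]
        norm_num
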